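/- **Setting.** There are $n\ge 1$ agents; agent $i$ chooses $x^i$ in a nonempty compact convex set $\mathcal X^i\subseteq\Delta([d^i])$, the probability simplex in $\mathbb R^{d^i}$. The principal case is $\mathcal X^i=\Delta([d^i])$; in general it is only required that $\mathcal X^i$ contains the uniform strategy $\mathbf 1/d^i$ and agrees with $\Delta([d^i])$ near the equilibrium strategies $x_*^i(\theta)$ below (both automatic for the full simplex). Put $\mathcal X=\prod_i\mathcal X^i$, $d=\sum_i d^i$, let $\lambda^i>0$ be weights and $\|\lambda\|_2^2=\sum_i(\lambda^i)^2$. For $\theta\in\Theta\subseteq\mathbb R^m$ let $v_\theta=(v^i_\theta)_i$ be the payoff gradients and $f(\theta,x)$ the designer's objective, both differentiable in $(\theta,x)$ at the points of $\Theta\times\mathcal X$. Write $$D(p,q)=\sum_j p_j\log(p_j/q_j)\in[0,\infty],\qquad \overline D_\psi(x,y)=\sum_i D(x^i,y^i)$$ for the Kullback–Leibler divergence (the Bregman divergence of the negative entropy). For $\theta\in\Theta$ let $x_*(\theta)\in\mathcal X$ be an equilibrium: $\sum_i\lambda^i\langle v_\theta^i(x_*(\theta)),x^i-x_*^i(\theta)\rangle\le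 0$ for all $x\in\mathcal X$. Let $f_*(\theta)=f(\theta,x_*(\theta))$ and let $\theta_*$ minimize $f_*$ over $\Theta$. Let $J_\theta=L-LA^\top[ALA^\top]^{-1}AL$, where $L=[\nabla_xv_\theta(x_*(\theta))]^{-1}$ and the rows of $A$ are the constraints of $\prod_i\Delta([d^i])$ active at $x_*(\theta)$ (the coordinate functionals vanishing at $x_*(\theta)$, and the total mass of each agent). Given estimates $\hat J(\theta,x)$ with $\hat J(\theta,x_*(\theta))=J_\theta$, the extended gradient is $$\tilde\nabla f(\theta,x)=\nabla_\theta f(\theta,x)-[\nabla_\theta v_\theta(x)]^\top\hat J(\theta,x)^\top\nabla_xf(\theta,x).$$ **Algorithm.** Given step sizes $\alpha_k$, $\beta^i_k$ and weights $\nu_k$, start from $\theta_0\in\Theta$, $\tilde x_0=x_0\in\mathcal X$ and iterate for $k\ge0$ $$x^i_{k+1}\in\arg\max_{y\in\mathcal X^i}\Bigl\{\langle\hat v^i_k,y\rangle-\tfrac1{\beta^i_k}D(y,\tilde x^i_k)\Bigr\},\quad \tilde x^i_{k+1}=(1-\nu_k)x^i_{k+1}+\nu_k\mathbf 1/d^i,$$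 $$\theta_{k+1}\in\arg\max_{\theta\in\Theta}\Bigl\{-\langle\hat\nabla f_k,\theta\rangle-\tfrac1{\alpha_k}\|\theta-\theta_k\|_2^2\Bigr\},$$ where $\hat v_k$ and $\hat\nabla f_k$ are random estimates of $v_{\theta_k}(\tilde x_k)$ and $\tilde\nabla f(\theta_k,\tilde x_{k+1})$. **Assumption 1.** There are $H_u,\rho_\theta,\rho_x>0$ such that for all $\theta\in\Theta$, $x,x'\in\mathcal X$ and $i$: $\|v^i_\theta(x)-v^i_\theta(x')\|_\infty^2\le H_u^2\overline D_\psi(x,x')$; $\|\nabla_\theta v_\theta(x)\|_2<\rho_\theta$; $\nabla_xv_\theta(x)$ is invertible with $\|[\nabla_xv_\theta(x)]^{-1}\|_2\le1/\rho_x$; and $\sum_i\lambda^i\langle v^i_\theta(x),x^i_*(\theta)-x^i\rangle\ge\overline D_\psi(x_*(\theta),x)$. **Assumption 2.** $\Theta$ is compact and convex, $f_*$ has a gradient $\nabla f_*$ on $\Theta$ (relative to $\Theta$), and there are $\mu,M,\tilde H>0$ such that for all $\theta,\theta'\in\Theta$, $x,x'\in\mathcal X$: $f_*(\theta)\ge f_*(\theta')+\langle\nabla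 f_*(\theta'),\theta-\theta'\rangle+\mu\|\theta-\theta'\|_2^2$; $\|\nabla f_*(\theta)\|_2\le M$; $\|\tilde\nabla f(\theta,x)-\tilde\nabla f(\theta,x')\|_2^2\le\tilde H^2\overline D_\psi(x,x')$. **Assumption 3.** Let $\mathcal F^\theta_k=\sigma(\theta_0,\dots,\theta_k,x_0,\dots,x_{k-1})$ and $\mathcal F^x_k=\sigma(\theta_0,\dots,\theta_k,x_0,\dots,x_k)$. The estimation errors are square integrable, and for some $\delta_f,\delta_u>0$ and all $k,i$: $\mathbb E[\hat\nabla f_k-\tilde\nabla f(\theta_k,\tilde x_{k+1})\mid\mathcal F^\theta_k]=0$, $\mathbb E[\hat v_k\mid\mathcal F^x_k]=v_{\theta_k}(\tilde x_k)$, $\mathbb E[\|\hat\nabla f_k-\tilde\nabla f(\theta_k,\tilde x_{k+1})\|_2^2\mid\mathcal F_k^\theta]\le\delta_f^2$, $\mathbb E[\|\hat v_k^i-v^i_{\theta_k}(\tilde x_k)\|_\infty^2\mid\mathcal F_k^x]\le\delta_u^2$. **Theorem.** Let Assumptions 1–3 hold, let $\|v_\theta(x_*(\theta))\|_\infty\le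 V_*$ for all $\theta\in\Theta$ and some $V_*>0$, and let $\alpha_k=\alpha/(k+1)^{1/2}$, $\beta_k=\beta/(k+1)^{2/7}$, $\beta_k^i=\lambda^i\beta_k$, $\nu_k=1/(k+1)^{4/7}$ with $\alpha,\beta>0$ such that $$\beta\le\frac1{6nH_u^2\|\lambda\|_2^2},\qquad \frac{\alpha}{\beta^{3/2}}\le\frac1{7\tilde H\tilde H_*},\qquad \tilde H_*=(1+d)\rho_\theta/\rho_x.$$ Then, with $\tilde x^i_*(\theta_k)=(1-\nu_k)x^i_*(\theta_k)+\nu_k\mathbf 1/d^i$, $$\mathbb E\|\theta_k-\theta_*\|_2^2=O(k^{-2/7}),\qquad \mathbb E\bigl[\overline D_\psi(\tilde x_*(\theta_k),\tilde x_{k+1})\bigr]=O((k+1)^{-2/7}).$$ -/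

import Mathlib

open MeasureTheory Filter Topology
open scoped ENNReal RealInnerProductSpace

noncomputable section

namespace IncentiveDesign

/-- The space of the designer's incentive parameters, with the Euclidean norm. -/
abbrev Param (m : ℕ) := EuclideanSpace ℝ (Fin m)

/-- The space `ℝ^{d¹ + ⋯ + dⁿ}` of joint strategy vectors, with the Euclidean norm; the entry
`⟨i, j⟩` is the weight that agent (class) `i` puts on its pure strategy `j`. -/
abbrev Profile {n : ℕ} (d : Fin n → ℕ) := EuclideanSpace ℝ (Σ i, Fin (d i))

/-- The block `xⁱ` of a joint vector. The norm on `Fin (d i) → ℝ` is the sup norm, that is the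
dual of the `ℓ¹` norm on the strategies of agent `i`. -/
def block {n : ℕ} {d : Fin n → ℕ} (x : Profile d) (i : Fin n) : Fin (d i) → ℝ :=
  fun j => x ⟨i, j⟩

open Classical in
/-- The Bregman divergence `D(p, q)` of the negative entropy `∑ p_j log p_j` on the simplex:
the Kullback-Leibler divergence `∑ p_j log (p_j / q_j)`, equal to `∞` if `q_j = 0 ≠ p_j`
for some `j`. -/
def klDiv {a : ℕ} (p q : Fin a → ℝ) : ℝ≥0∞ :=
  if ∀ j, q j = 0 → p j = 0 then ENNReal.ofReal (∑ j, p j * Real.log (p j / q j)) else ⊤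

/-- The sum over the agents of the divergences of the blocks. -/
def klBar {n : ℕ} {d : Fin n → ℕ} (x y : Profile d) : ℝ≥0∞ :=
  ∑ i, klDiv (block x i) (block y i)

/-- Mixing every block of `x` with the uniform strategy, with weight `w` on the latter. -/
def mix {n : ℕ} {d : Fin n → ℕ} (w : ℝ) (x : Profile d) : Profile d :=
  WithLp.toLp 2 fun p => (1 - w) * x p + w * (1 / (d p.1 : ℝ))

/-- The data of an incentive design problem: the parameter set `Θ`, the strategy sets `X i`,
the weights `lam i` of the agents, the payoff gradients `v θ x` and the designer's
objective `f θ x`. -/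
structure Design (m n : ℕ) (d : Fin n → ℕ) where
  Θ : Set (Param m)
  X : ∀ i, Set (Fin (d i) → ℝ)
  lam : Fin n → ℝ
  v : Param m → Profile d → Profile d
  f : Param m → Profile d → ℝ

variable {m n : ℕ} {d : Fin n → ℕ}

namespace Design

/-- The set of joint strategies, the product of the `X i`. -/
def profiles (G : Design m n d) : Set (Profile d) := {x | ∀ i, block x i ∈ G.X i}

/-- The weighted pairing `∑ i, λⁱ ⟨vⁱ_θ(x), yⁱ - zⁱ⟩`. -/
def pairing (G : Design m n d) (θ : Param m) (x y z : Profile d) : ℝ :=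
  ∑ i, G.lam i * ∑ j, block (G.v θ x) i j * (block y i j - block z i j)

/-- `x` solves the variational inequality of the game with parameter `θ`. -/
def IsEquilibrium (G : Design m n d) (θ : Param m) (x : Profile d) : Prop :=
  x ∈ G.profiles ∧ ∀ y ∈ G.profiles, G.pairing θ x y x ≤ 0

/-- The Jacobian matrix `∇ₓ v_θ(x)`. -/
def jacX (G : Design m n d) (θ : Param m) (x : Profile d) :
    Matrix (Σ i, Fin (d i)) (Σ i, Fin (d i)) ℝ :=
  Matrix.of fun p q => fderiv ℝ (G.v θ) x (EuclideanSpace.single q 1) p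

/-- The Jacobian `∇_θ v_θ(x)`, as a linear map. -/
def jacTheta (G : Design m n d) (θ : Param m) (x : Profile d) : Param m →L[ℝ] Profile d :=
  fderiv ℝ (fun t => G.v t x) θ

/-- The matrix of the constraints of the product of simplices that are active at `x`: one row
for each vanishing entry of `x`, and one row for the total mass of each agent. -/
def activeMatrix (x : Profile d) :
    Matrix ({p : Σ i, Fin (d i) // x p = 0} ⊕ Fin n) (Σ i, Fin (d i)) ℝ :=
  Matrix.of (Sum.elim (fun r q => if r.1 = q then 1 else 0) (fun i q => if q.1 = i then 1 else 0))

open Classical in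
/-- `L - L Aᵀ (A L Aᵀ)⁻¹ A L`, where `L` is the inverse of `∇ₓ v_θ(x)` and `A` is the matrix of
the constraints that are active at `x`. At an equilibrium `x`, this is the matrix `J_θ`. -/
def sensMatrix (G : Design m n d) (θ : Param m) (x : Profile d) :
    Matrix (Σ i, Fin (d i)) (Σ i, Fin (d i)) ℝ :=
  let L := (G.jacX θ x)⁻¹
  let A := activeMatrix x
  L - L * A.transpose * (A * L * A.transpose)⁻¹ * A * L

/-- The extended gradient `∇_θ f(θ, x) - [∇_θ v_θ(x)]ᵀ Ĵᵀ ∇ₓ f(θ, x)`, for the estimate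
`Jhat θ x` of `J_θ`. -/
def extGrad (G : Design m n d)
    (Jhat : Param m → Profile d → Matrix (Σ i, Fin (d i)) (Σ i, Fin (d i)) ℝ)
    (θ : Param m) (x : Profile d) : Param m :=
  gradient (fun t => G.f t x) θ
    - (G.jacTheta θ x).adjoint
        (Matrix.toEuclideanCLM (𝕜 := ℝ) (Jhat θ x).transpose (gradient (G.f θ) x))

/-- Strategy sets inside the probability simplices. The case of the full simplices is
`G.X i = stdSimplex ℝ (Fin (d i))`, for which all fields hold trivially as soon as every `d i`
is positive and the `xs θ` are joint strategies. In general, mixing with the uniform strategy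
must not leave `X i`, and `X i` must agree with the simplex near the equilibria, so that the
constraints of the simplex are the ones that are active there. -/
structure SimplexConstrained (G : Design m n d) (xs : Param m → Profile d) : Prop where
  subset_simplex : ∀ i, G.X i ⊆ stdSimplex ℝ (Fin (d i))
  uniform_mem : ∀ i, (fun _ => 1 / (d i : ℝ)) ∈ G.X i
  nhds_equilibrium : ∀ θ ∈ G.Θ, ∀ i, G.X i ∈ 𝓝[stdSimplex ℝ (Fin (d i))] (block (xs θ) i)

/-- The assumptions on the lower level; `xs θ` is the equilibrium for the parameter `θ`. -/
structure GameAssumption (G : Design m n d) (xs : Param m → Profile d) (Hu ρθ ρx : ℝ) :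
    Prop where
  lam_pos : ∀ i, 0 < G.lam i
  Hu_pos : 0 < Hu
  ρθ_pos : 0 < ρθ
  ρx_pos : 0 < ρx
  nonempty : ∀ i, (G.X i).Nonempty
  compact : ∀ i, IsCompact (G.X i)
  convex : ∀ i, Convex ℝ (G.X i)
  differentiable : ∀ θ ∈ G.Θ, ∀ x ∈ G.profiles,
    DifferentiableAt ℝ (fun z : Param m × Profile d => G.v z.1 z.2) (θ, x)
  equilibrium : ∀ θ ∈ G.Θ, G.IsEquilibrium θ (xs θ)
  lipschitz : ∀ θ ∈ G.Θ, ∀ i, ∀ x ∈ G.profiles, ∀ y ∈ G.profiles,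
    ENNReal.ofReal (‖block (G.v θ x) i - block (G.v θ y) i‖ ^ 2)
      ≤ ENNReal.ofReal (Hu ^ 2) * klBar x y
  jacTheta_bound : ∀ θ ∈ G.Θ, ∀ x ∈ G.profiles, ‖G.jacTheta θ x‖ < ρθ
  jacX_invertible : ∀ θ ∈ G.Θ, ∀ x ∈ G.profiles, IsUnit (G.jacX θ x).det
  jacX_inv_bound : ∀ θ ∈ G.Θ, ∀ x ∈ G.profiles,
    ‖Matrix.toEuclideanCLM (𝕜 := ℝ) (G.jacX θ x)⁻¹‖ ≤ 1 / ρx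
  variationally_stable : ∀ θ ∈ G.Θ, ∀ x ∈ G.profiles,
    ((klBar (xs θ) x : ℝ≥0∞) : EReal) ≤ ((G.pairing θ x (xs θ) x : ℝ) : EReal)

/-- The reduced objective `f_*(θ) = f(θ, x_*(θ))`. -/
def reduced (G : Design m n d) (xs : Param m → Profile d) (θ : Param m) : ℝ := G.f θ (xs θ)

/-- The assumptions on the upper level; `gradF` is the gradient of the reduced objective on `Θ`
(relative to `Θ`, since `x_*` is given on `Θ` only), and the estimate `Jhat` of `J_θ` is exact at
the equilibrium, so that the extended gradient extends it. -/
structure ObjectiveAssumption (G : Design m n d) (xs : Param m → Profile d)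
    (Jhat : Param m → Profile d → Matrix (Σ i, Fin (d i)) (Σ i, Fin (d i)) ℝ)
    (gradF : Param m → Param m) (μ M Ht : ℝ) : Prop where
  μ_pos : 0 < μ
  M_pos : 0 < M
  Ht_pos : 0 < Ht
  compact : IsCompact G.Θ
  convex : Convex ℝ G.Θ
  differentiable : ∀ θ ∈ G.Θ, ∀ x ∈ G.profiles,
    DifferentiableAt ℝ (fun z : Param m × Profile d => G.f z.1 z.2) (θ, x)
  hasGradient : ∀ θ ∈ G.Θ, HasGradientWithinAt (G.reduced xs) (gradF θ) G.Θ θ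
  strongly_convex : ∀ θ ∈ G.Θ, ∀ θ' ∈ G.Θ,
    G.reduced xs θ' + ⟪gradF θ', θ - θ'⟫ + μ * ‖θ - θ'‖ ^ 2 ≤ G.reduced xs θ
  gradient_bound : ∀ θ ∈ G.Θ, ‖gradF θ‖ ≤ M
  exact_at_equilibrium : ∀ θ ∈ G.Θ, Jhat θ (xs θ) = G.sensMatrix θ (xs θ)
  lipschitz : ∀ θ ∈ G.Θ, ∀ x ∈ G.profiles, ∀ y ∈ G.profiles,
    ENNReal.ofReal (‖G.extGrad Jhat θ x - G.extGrad Jhat θ y‖ ^ 2)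
      ≤ ENNReal.ofReal (Ht ^ 2) * klBar x y

end Design

/-- The mixed strategies: `x̃₀ = x₀` and `x̃_{k+1}` is `x_{k+1}` mixed with weight `ν k`. -/
def mixedSeq {Ω : Type*} (ν : ℕ → ℝ) (x : ℕ → Ω → Profile d) : ℕ → Ω → Profile d
  | 0 => x 0
  | k + 1 => fun ω => mix (ν k) (x (k + 1) ω)

/-- The sequences `θ`, `x` are generated by bi-level incentive design with entropic mirror
descent for the agents, from the payoff estimates `vhat` and the gradient estimates `ghat`,
with step sizes `a k` of the designer and `lam i * b k` of agent `i`, and mixing weights `ν k`. -/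
structure IsTrajectory {Ω : Type*} (G : Design m n d) (a b ν : ℕ → ℝ)
    (vhat : ℕ → Ω → Profile d) (ghat : ℕ → Ω → Param m)
    (θ : ℕ → Ω → Param m) (x : ℕ → Ω → Profile d) : Prop where
  θ_init : ∀ ω, θ 0 ω ∈ G.Θ
  x_init : ∀ ω, x 0 ω ∈ G.profiles
  x_mem : ∀ k ω, x (k + 1) ω ∈ G.profiles
  x_step : ∀ k ω i, IsMaxOn
    (fun y : Fin (d i) → ℝ => ((∑ j, block (vhat k ω) i j * y j : ℝ) : EReal)
      - ((1 / (G.lam i * b k) : ℝ) : EReal)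
        * ((klDiv y (block (mixedSeq ν x k ω) i) : ℝ≥0∞) : EReal))
    (G.X i) (block (x (k + 1) ω) i)
  θ_mem : ∀ k ω, θ (k + 1) ω ∈ G.Θ
  θ_step : ∀ k ω, IsMaxOn
    (fun t : Param m => -⟪ghat k ω, t⟫ - 1 / a k * ‖t - θ k ω‖ ^ 2) G.Θ (θ (k + 1) ω)

/-- The history `σ(θ_0, …, θ_k, x_0, …, x_{k-1})`. -/
@[reducible] def histTheta {Ω : Type*} (θ : ℕ → Ω → Param m) (x : ℕ → Ω → Profile d) (k : ℕ) :
    MeasurableSpace Ω :=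
  (⨆ l ∈ Set.Iic k, MeasurableSpace.comap (θ l) inferInstance)
    ⊔ ⨆ l ∈ Set.Iio k, MeasurableSpace.comap (x l) inferInstance

/-- The history `σ(θ_0, …, θ_k, x_0, …, x_k)`. -/
@[reducible] def histX {Ω : Type*} (θ : ℕ → Ω → Param m) (x : ℕ → Ω → Profile d) (k : ℕ) :
    MeasurableSpace Ω :=
  (⨆ l ∈ Set.Iic k, MeasurableSpace.comap (θ l) inferInstance)
    ⊔ ⨆ l ∈ Set.Iic k, MeasurableSpace.comap (x l) inferInstance

/-- The estimates are unbiased with conditionally bounded mean squared errors. For the designer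
the conditional mean of the error is required to vanish, which is the same as unbiasedness
if `x_{k+1}` is part of the history, and makes sense if it is not. -/
structure EstimateAssumption {Ω : Type*} [MeasurableSpace Ω] (P : Measure Ω)
    (G : Design m n d)
    (Jhat : Param m → Profile d → Matrix (Σ i, Fin (d i)) (Σ i, Fin (d i)) ℝ)
    (ν : ℕ → ℝ) (vhat : ℕ → Ω → Profile d) (ghat : ℕ → Ω → Param m)
    (θ : ℕ → Ω → Param m) (x : ℕ → Ω → Profile d) (δf δu : ℝ) : Prop where
  δf_pos : 0 < δf
  δu_pos : 0 < δu
  θ_measurable : ∀ k, Measurable (θ k)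
  x_measurable : ∀ k, Measurable (x k)
  vhat_measurable : ∀ k, Measurable (vhat k)
  ghat_measurable : ∀ k, Measurable (ghat k)
  vhat_memLp : ∀ k, MemLp (fun ω => vhat k ω - G.v (θ k ω) (mixedSeq ν x k ω)) 2 P
  ghat_memLp : ∀ k,
    MemLp (fun ω => ghat k ω - G.extGrad Jhat (θ k ω) (mixedSeq ν x (k + 1) ω)) 2 P
  vhat_unbiased : ∀ k,
    P[vhat k | histX θ x k] =ᵐ[P] fun ω => G.v (θ k ω) (mixedSeq ν x k ω)
  ghat_unbiased : ∀ k,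
    P[fun ω => ghat k ω - G.extGrad Jhat (θ k ω) (mixedSeq ν x (k + 1) ω) | histTheta θ x k]
      =ᵐ[P] 0
  vhat_error : ∀ k i,
    P[fun ω => ‖block (vhat k ω) i - block (G.v (θ k ω) (mixedSeq ν x k ω)) i‖ ^ 2
      | histX θ x k] ≤ᵐ[P] fun _ => δu ^ 2
  ghat_error : ∀ k,
    P[fun ω => ‖ghat k ω - G.extGrad Jhat (θ k ω) (mixedSeq ν x (k + 1) ω)‖ ^ 2
      | histTheta θ x k] ≤ᵐ[P] fun _ => δf ^ 2

end IncentiveDesign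

end

/-!
The variational stability of the equilibria bounds the divergence `klBar (xs θ) x` by a finite
number for every joint strategy `x`. Hence no strategy may vanish where an equilibrium does not:
all equilibria have the same support, and by compactness the strategies are bounded below there by
some `ε > 0` (`GameAssumption.exists_supportFloor`). On that common support the relative entropy
`klReal (xs θ) ·` is a bounded and smooth function of both arguments. In particular the divergence
from the equilibrium is bounded, and with it the payoff gradients and the error of the extended
gradient.

The same stability yields the regularity of the equilibrium map. Together with the quadratic lower
bound for the relative entropy it makes `xs` Lipschitz on `Θ`, and it makes the weighted Jacobian
of the payoffs negative definite on the face of the equilibrium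
(`GameAssumption.sum_lam_mul_fderiv_le`). So the Schur complement in `sensMatrix` is invertible,
and differentiating the condition that payoffs be constant on the support shows that `xs` has the
derivative `-J ∇_θ v` within `Θ`. The chain rule identifies the extended gradient at the
equilibrium with a gradient of the reduced objective, as far as displacements inside `Θ` are
concerned (`GameAssumption.inner_extGrad_eq`); the projection of the designer sees no others.

The convergence proof follows `u k = E klReal (xs (θ k)) (x (k + 1))` and `E ‖θ k - θs‖ ^ 2`. An
entropic mirror step contracts the divergence by `1 - b k`, up to `O(b k ^ 2)`; mixing with the
uniform strategies costs `O(ν k)`; the motion of the equilibrium costs `O(a k ^ 2 / b k)`, because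
a quantity linear in the displacement is absorbed into half of the contraction. All three are
`O(k ^ (-4 / 7))` and the contraction is of order `k ^ (-2 / 7)`, which gives `u k = O(k ^ (-2 / 7))`
(`Run.exists_agents_rate`). The projected gradient step of the designer contracts by `1 - c a k`,
with an error `O(a k * u k + a k * ν k + a k ^ 2)`, so the squared distance to the optimum inherits
the same rate (`Run.exists_designer_rate`). Both follow from the recursive inequality
`exists_le_rpow_of_recursion`. The divergence between the mixed strategies is controlled by the one
between the strategies themselves, by joint convexity.
-/

namespace IncentiveDesign

/-! ### Termwise inequalities for the relative entropy -/

/-- A quadratic lower bound (a weak form of Pinsker's inequality, term by term), obtained by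
comparing both sides with `(√p - √q) ^ 2`. -/
theorem sq_sub_div_four_le {p q : ℝ} (hp : 0 ≤ p) (hp1 : p ≤ 1) (hq : 0 ≤ q) (hq1 : q ≤ 1)
    (h : q = 0 → p = 0) : (p - q) ^ 2 / 4 ≤ p * Real.log (p / q) - p + q := by
  rcases hp.eq_or_lt with rfl | hp
  · simp only [zero_mul]; nlinarith
  have hq : 0 < q := hq.lt_of_ne fun h0 => hp.ne' (h h0.symm)
  obtain ⟨a, ha, rfl⟩ : ∃ a, 0 < a ∧ p = a ^ 2 :=
    ⟨√p, Real.sqrt_pos.2 hp, (Real.sq_sqrt hp.le).symm⟩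
  obtain ⟨b, hb, rfl⟩ : ∃ b, 0 < b ∧ q = b ^ 2 :=
    ⟨√q, Real.sqrt_pos.2 hq, (Real.sq_sqrt hq.le).symm⟩
  have hlog : Real.log (a ^ 2 / b ^ 2) = -2 * Real.log (b / a) := by
    rw [← div_pow, Real.log_pow, ← inv_div b a, Real.log_inv]; push_cast; ring
  have h1 : Real.log (b / a) ≤ b / a - 1 := Real.log_le_sub_one_of_pos (by positivity)
  have h2 : a ^ 2 * Real.log (b / a) ≤ a * b - a ^ 2 := by
    calc a ^ 2 * Real.log (b / a) ≤ a ^ 2 * (b / a - 1) := by gcongr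
      _ = a * b - a ^ 2 := by field_simp
  have ha1 : a ≤ 1 := by nlinarith
  have hb1 : b ≤ 1 := by nlinarith
  have h3 : (a + b) ^ 2 ≤ 4 := by nlinarith
  have h4 : (a ^ 2 - b ^ 2) ^ 2 / 4 ≤ (a - b) ^ 2 := by
    have := mul_le_mul_of_nonneg_left h3 (sq_nonneg (a - b))
    nlinarith
  rw [hlog]
  nlinarith

/-- Mixing the second argument with `c` increases a term of the relative entropy by at most a
multiple of the mixing weight. -/
theorem mul_log_div_mix_le {p q w c : ℝ} (hp : 0 ≤ p) (hp1 : p ≤ 1) (hq : 0 < q) (hq1 : q ≤ 1)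
    (hw : 0 ≤ w) (hw1 : w ≤ 1) (hc : 0 < c) (hc1 : c ≤ 1) :
    p * Real.log (p / ((1 - w) * q + w * c)) ≤ p * Real.log (p / q) + w * -Real.log c := by
  rcases hp.eq_or_lt with rfl | hp
  · have := Real.log_nonpos hc.le hc1
    simp only [zero_mul, zero_add]; nlinarith
  have hconc := strictConcaveOn_log_Ioi.concaveOn.2 (Set.mem_Ioi.2 hq) (Set.mem_Ioi.2 hc)
    (sub_nonneg.2 hw1) hw (by ring)
  simp only [smul_eq_mul] at hconc
  have hmix : 0 < (1 - w) * q + w * c := by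
    rcases hw.eq_or_lt with rfl | hw
    · simpa using hq
    · have := mul_nonneg (sub_nonneg.2 hw1) hq.le
      positivity
  rw [Real.log_div hp.ne' hmix.ne', Real.log_div hp.ne' hq.ne']
  have h1 := Real.log_nonpos hq.le hq1
  have h2 := Real.log_nonpos hc.le hc1
  have h3 : Real.log q + w * Real.log c ≤ Real.log ((1 - w) * q + w * c) := by nlinarith
  have h4 : w * Real.log c * 1 ≤ w * Real.log c * p :=
    mul_le_mul_of_nonpos_left hp1 (mul_nonpos_of_nonneg_of_nonpos hw h2)
  nlinarith [mul_le_mul_of_nonneg_left h3 hp.le]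

/-- The log-sum inequality, in the case where the second pair consists of equal numbers: adding
`b` to both arguments does not increase a term of the relative entropy. -/
theorem add_mul_log_div_add_le {p q b : ℝ} (hp : 0 ≤ p) (hq : 0 ≤ q) (hb : 0 < b)
    (h : q = 0 → p = 0) :
    (p + b) * Real.log ((p + b) / (q + b)) ≤ p * Real.log (p / q) := by
  rcases hp.eq_or_lt with rfl | hp
  · simp only [zero_mul, zero_add]
    exact mul_nonpos_of_nonneg_of_nonpos hb.le
      (Real.log_nonpos (by positivity) ((div_le_one (by positivity)).2 (by linarith)))
  have hq : 0 < q := hq.lt_of_ne fun h0 => hp.ne' (h h0.symm)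
  have h1 : Real.log ((p + b) / (q + b)) - Real.log (p / q)
      ≤ (p + b) / (q + b) * (q / p) - 1 := by
    rw [← Real.log_div (by positivity) (by positivity), div_div_eq_mul_div, mul_div_assoc]
    refine (Real.log_le_sub_one_of_pos (by positivity)).trans_eq ?_
    field_simp
  have h2 : Real.log ((p + b) / (q + b)) ≤ (p + b) / (q + b) - 1 :=
    Real.log_le_sub_one_of_pos (by positivity)
  have h3 : p * ((p + b) / (q + b) * (q / p) - 1) + b * ((p + b) / (q + b) - 1) = 0 := by
    field_simp; ring
  nlinarith [mul_le_mul_of_nonneg_left h1 hp.le, mul_le_mul_of_nonneg_left h2 hb.le]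

/-- Moving the first argument from `p` to `p'`, away from `0`, changes a term of the relative
entropy by a quantity of second order, once the change of mass has been subtracted. -/
theorem mul_log_div_sub_le {ε p p' q : ℝ} (hε : 0 < ε) (hp : ε ≤ p) (hp' : ε ≤ p') (hq : ε ≤ q) :
    p' * Real.log (p' / q) - p' ≤ p * Real.log (p / q) - p
      + |p' - p| * |p - q| / ε + (p' - p) ^ 2 / ε := by
  have hp0 := hε.trans_le hp
  have hp0' := hε.trans_le hp'
  have hq0 := hε.trans_le hq
  have h1 : p' * (Real.log p' - Real.log p) ≤ p' * (p' / p - 1) := by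
    rw [← Real.log_div hp0'.ne' hp0.ne']
    gcongr
    exact Real.log_le_sub_one_of_pos (by positivity)
  have h2 : p' * (p' / p - 1) = (p' - p) + (p' - p) ^ 2 / p := by field_simp; ring
  have h3 : (p' - p) ^ 2 / p ≤ (p' - p) ^ 2 / ε := by gcongr
  have h4 : |Real.log p - Real.log q| ≤ |p - q| / ε := by
    rw [abs_le]
    constructor
    · have : Real.log q - Real.log p ≤ |p - q| / ε := by
        rw [← Real.log_div hq0.ne' hp0.ne']
        refine (Real.log_le_sub_one_of_pos (by positivity)).trans ?_
        rw [div_sub_one hp0.ne']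
        calc (q - p) / p ≤ |p - q| / p := by
              gcongr; rw [abs_sub_comm]; exact le_abs_self _
          _ ≤ _ := by gcongr
      linarith
    · rw [← Real.log_div hp0.ne' hq0.ne']
      refine (Real.log_le_sub_one_of_pos (by positivity)).trans ?_
      rw [div_sub_one hq0.ne']
      calc (p - q) / q ≤ |p - q| / q := by
            gcongr; exact le_abs_self _
        _ ≤ _ := by gcongr
  have h5 : (p' - p) * (Real.log p - Real.log q) ≤ |p' - p| * |p - q| / ε := by
    refine (le_abs_self _).trans ?_
    rw [abs_mul, mul_div_assoc]
    gcongr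
  rw [Real.log_div hp0'.ne' hq0.ne', Real.log_div hp0.ne' hq0.ne']
  nlinarith

/-! ### The entropic mirror step -/

theorem sum_sq_sub_div_four_le {ι : Type*} [Fintype ι] {p q : ι → ℝ} (hp : p ∈ stdSimplex ℝ ι)
    (hq : q ∈ stdSimplex ℝ ι) (h : ∀ j, q j = 0 → p j = 0) :
    ∑ j, (p j - q j) ^ 2 / 4 ≤ ∑ j, p j * Real.log (p j / q j) := by
  have hle : ∀ {r : ι → ℝ}, r ∈ stdSimplex ℝ ι → ∀ j, r j ≤ 1 := fun hr j => by
    rw [← hr.2]; exact Finset.single_le_sum (fun i _ => hr.1 i) (Finset.mem_univ j)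
  have h1 := Finset.sum_le_sum fun j (_ : j ∈ Finset.univ) =>
    sq_sub_div_four_le (hp.1 j) (hle hp j) (hq.1 j) (hle hq j) (h j)
  rw [Finset.sum_add_distrib, Finset.sum_sub_distrib, hp.2, hq.2] at h1
  linarith

/-- A bound by a linear function with an arbitrarily small error is a bound without error. -/
theorem le_of_forall_le_add_mul {A B C : ℝ} (h : ∀ t : ℝ, 0 < t → t ≤ 1 → A ≤ B + t * C) :
    A ≤ B := by
  have hlim : Tendsto (fun t : ℝ => B + t * C) (𝓝[>] 0) (𝓝 (B + 0 * C)) :=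
    ((continuous_const.add (continuous_id.mul continuous_const)).tendsto 0).mono_left
      nhdsWithin_le_nhds
  rw [zero_mul, add_zero] at hlim
  refine ge_of_tendsto hlim ?_
  filter_upwards [Ioc_mem_nhdsGT (zero_lt_one (α := ℝ))] with t ht using h t ht.1 ht.2

/-- The three-point inequality of the entropic mirror step. The maximality of `z` is used along
the segment from `z` to `u`, on which the coordinates where `z` vanishes are constantly `0`. -/
theorem mirror_three_point {ι : Type*} [Fintype ι] {X : Set (ι → ℝ)} (hX : Convex ℝ X)
    (hXs : X ⊆ stdSimplex ℝ ι) {c : ℝ} (hc : 0 < c) (v : ι → ℝ) {w z u : ι → ℝ}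
    (hw : ∀ j, 0 < w j) (hz : z ∈ X) (hu : u ∈ X) (hsupp : ∀ j, z j = 0 → u j = 0)
    (hmax : ∀ y ∈ X, ∑ j, v j * y j - 1 / c * ∑ j, y j * Real.log (y j / w j)
      ≤ ∑ j, v j * z j - 1 / c * ∑ j, z j * Real.log (z j / w j)) :
    ∑ j, u j * Real.log (u j / z j) ≤ ∑ j, u j * Real.log (u j / w j)
      - ∑ j, z j * Real.log (z j / w j) + c * ∑ j, v j * (z j - u j) := by
  have hz0 := (hXs hz).1
  have hu0 := (hXs hu).1
  have hsum : ∑ j, (u j - z j) = 0 := by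
    rw [Finset.sum_sub_distrib, (hXs hz).2, (hXs hu).2, sub_self]
  have hfirst : c * ∑ j, v j * (u j - z j) ≤ ∑ j, (u j - z j) * Real.log (z j / w j) := by
    refine le_of_forall_le_add_mul (C := ∑ j, (u j - z j) ^ 2 / z j) fun t ht ht1 => ?_
    have hy : z + t • (u - z) ∈ X := hX.add_smul_sub_mem hz hu ⟨ht.le, ht1⟩
    have hterm : ∀ j, (z + t • (u - z)) j * Real.log ((z + t • (u - z)) j / w j)
        ≤ z j * Real.log (z j / w j) + t * (u j - z j) + t ^ 2 * ((u j - z j) ^ 2 / z j)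
          + t * ((u j - z j) * Real.log (z j / w j)) := by
      intro j
      simp only [Pi.add_apply, Pi.smul_apply, Pi.sub_apply, smul_eq_mul]
      rcases (hz0 j).eq_or_lt with h0 | h0
      · rw [← h0, hsupp j h0.symm]; simp
      rcases ((hXs hy).1 j).eq_or_lt with h1 | h1
      · simp only [Pi.add_apply, Pi.smul_apply, Pi.sub_apply, smul_eq_mul] at h1
        rw [← h1]
        have h2 : t * (u j - z j) = -z j := by linarith
        have h3 : t ^ 2 * ((u j - z j) ^ 2 / z j) = z j := by
          rw [← mul_div_assoc, ← mul_pow, h2]; field_simp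
        have h4 : t * ((u j - z j) * Real.log (z j / w j)) = -z j * Real.log (z j / w j) := by
          rw [← mul_assoc, h2]
        rw [h3, h4, h2]; apply le_of_eq; ring
      simp only [Pi.add_apply, Pi.smul_apply, Pi.sub_apply, smul_eq_mul] at h1
      set y := z j + t * (u j - z j) with hydef
      have h2 : Real.log (y / w j) - Real.log (z j / w j) ≤ y / z j - 1 := by
        rw [← Real.log_div (div_pos h1 (hw j)).ne' (div_pos h0 (hw j)).ne',
          div_div_div_cancel_right₀ (hw j).ne']
        exact Real.log_le_sub_one_of_pos (by positivity)
      have h3 : y * (y / z j - 1) = t * (u j - z j) + t ^ 2 * ((u j - z j) ^ 2 / z j) := by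
        rw [hydef]; field_simp; ring
      have h4 := mul_le_mul_of_nonneg_left h2 h1.le
      have h5 : y * Real.log (z j / w j)
          = z j * Real.log (z j / w j) + t * ((u j - z j) * Real.log (z j / w j)) := by
        rw [hydef]; ring
      linarith
    have hle := Finset.sum_le_sum fun j (_ : j ∈ Finset.univ) => hterm j
    simp only [Finset.sum_add_distrib, ← Finset.mul_sum] at hle
    rw [hsum] at hle
    have hopt := hmax _ hy
    have hlin : ∑ j, v j * (z + t • (u - z)) j
        = ∑ j, v j * z j + t * ∑ j, v j * (u j - z j) := by
      rw [Finset.mul_sum, ← Finset.sum_add_distrib]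
      refine Finset.sum_congr rfl fun j _ => ?_
      simp only [Pi.add_apply, Pi.smul_apply, Pi.sub_apply, smul_eq_mul]; ring
    rw [hlin] at hopt
    have hopt' := mul_le_mul_of_nonneg_left hopt hc.le
    have hcc : c * (1 / c) = 1 := by field_simp
    have hopt2 : c * t * ∑ j, v j * (u j - z j)
        ≤ ∑ j, (z + t • (u - z)) j * Real.log ((z + t • (u - z)) j / w j)
          - ∑ j, z j * Real.log (z j / w j) := by
      rw [mul_sub, mul_sub, ← mul_assoc c (1 / c), ← mul_assoc c (1 / c), hcc] at hopt'
      linarith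
    refine le_of_mul_le_mul_left ?_ ht
    linarith
  have hid : ∑ j, (u j - z j) * Real.log (z j / w j) = ∑ j, u j * Real.log (u j / w j)
      - ∑ j, u j * Real.log (u j / z j) - ∑ j, z j * Real.log (z j / w j) := by
    rw [← Finset.sum_sub_distrib, ← Finset.sum_sub_distrib]
    refine Finset.sum_congr rfl fun j _ => ?_
    rcases (hu0 j).eq_or_lt with h0 | h0
    · rw [← h0]; ring
    have hz1 : z j ≠ 0 := fun h => h0.ne' (hsupp j h)
    rw [Real.log_div h0.ne' (hw j).ne', Real.log_div h0.ne' hz1, Real.log_div hz1 (hw j).ne']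
    ring
  have hneg : ∑ j, v j * (z j - u j) = -∑ j, v j * (u j - z j) := by
    rw [← Finset.sum_neg_distrib]
    exact Finset.sum_congr rfl fun j _ => by ring
  rw [hid] at hfirst
  rw [hneg]
  linarith

/-- One entropic mirror step: the divergence to any competitor `u` decreases by the step size
times the linear gain at the starting point `w`, up to a second order term. -/
theorem mirror_step {ι : Type*} [Fintype ι] {X : Set (ι → ℝ)} (hX : Convex ℝ X)
    (hXs : X ⊆ stdSimplex ℝ ι) {c : ℝ} (hc : 0 < c) (v : ι → ℝ) {w z u : ι → ℝ}
    (hw : ∀ j, 0 < w j) (hwX : w ∈ X) (hz : z ∈ X) (hu : u ∈ X) (hsupp : ∀ j, z j = 0 → u j = 0)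
    (hmax : ∀ y ∈ X, ∑ j, v j * y j - 1 / c * ∑ j, y j * Real.log (y j / w j)
      ≤ ∑ j, v j * z j - 1 / c * ∑ j, z j * Real.log (z j / w j)) :
    ∑ j, u j * Real.log (u j / z j) ≤ ∑ j, u j * Real.log (u j / w j)
      + c * ∑ j, v j * (w j - u j) + c ^ 2 * ∑ j, v j ^ 2 := by
  have h1 := mirror_three_point hX hXs hc v hw hz hu hsupp hmax
  have h2 := sum_sq_sub_div_four_le (hXs hz) (hXs hwX) fun j h => absurd h (hw j).ne'
  have h3 : c * ∑ j, v j * (z j - u j) ≤ c * ∑ j, v j * (w j - u j) + c ^ 2 * ∑ j, v j ^ 2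
      + ∑ j, (z j - w j) ^ 2 / 4 := by
    simp only [Finset.mul_sum, ← Finset.sum_add_distrib]
    refine Finset.sum_le_sum fun j _ => ?_
    nlinarith [sq_nonneg (c * v j - (z j - w j) / 2)]
  linarith

/-! ### A recursive inequality -/

/-- If `u` contracts by the factor `1 - c t ^ (-s)` and gains at most `C t ^ (-(s + r))` at time
`t = k + 1`, then `u` decays like `t ^ (-r)`. -/
theorem exists_le_rpow_of_recursion {u : ℕ → ℝ} {c C s r : ℝ} {K : ℕ} (hc : 0 < c)
    (hs : 0 < s) (hs1 : s < 1) (hr1 : r ≤ 1)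
    (hu : ∀ k ≥ K, u (k + 1) ≤ (1 - c * ((k : ℝ) + 1) ^ (-s)) * u k
      + C * ((k : ℝ) + 1) ^ (-(s + r))) :
    ∃ B : ℝ, 0 ≤ B ∧ ∀ k, u k ≤ B * ((k : ℝ) + 1) ^ (-r) := by
  have htend : Tendsto (fun k : ℕ => (k : ℝ) + 1) atTop atTop :=
    tendsto_atTop_add_const_right _ _ tendsto_natCast_atTop_atTop
  have h1 : ∀ᶠ k : ℕ in atTop, c * ((k : ℝ) + 1) ^ (-s) < 1 := by
    have := ((tendsto_rpow_neg_atTop hs).comp htend).const_mul c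
    rw [mul_zero] at this
    exact this.eventually_lt_const one_pos
  have h2 : ∀ᶠ k : ℕ in atTop, ((k : ℝ) + 1) ^ (-(1 - s)) < c / 2 :=
    ((tendsto_rpow_neg_atTop (sub_pos.2 hs1)).comp htend).eventually_lt_const (half_pos hc)
  obtain ⟨N, hN⟩ := (h1.and (h2.and (eventually_ge_atTop K))).exists_forall_of_atTop
  have hbase : ∃ B : ℝ, 2 * |C| / c ≤ B ∧ ∀ k ≤ N, u k ≤ B * ((k : ℝ) + 1) ^ (-r) := by
    refine ⟨2 * |C| / c + ∑ k ∈ Finset.range (N + 1), |u k| * ((k : ℝ) + 1) ^ r, ?_, ?_⟩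
    · exact le_add_of_nonneg_right (Finset.sum_nonneg fun k _ => by positivity)
    · intro k hk
      have hpos : (0 : ℝ) < (k : ℝ) + 1 := by positivity
      rw [Real.rpow_neg hpos.le, ← div_eq_mul_inv, le_div_iff₀ (by positivity)]
      calc u k * ((k : ℝ) + 1) ^ r ≤ |u k| * ((k : ℝ) + 1) ^ r := by
            gcongr; exact le_abs_self _
        _ ≤ ∑ k ∈ Finset.range (N + 1), |u k| * ((k : ℝ) + 1) ^ r :=
            Finset.single_le_sum (f := fun k : ℕ => |u k| * ((k : ℝ) + 1) ^ r)
              (fun k _ => by positivity) (Finset.mem_range.2 (by omega))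
        _ ≤ _ := le_add_of_nonneg_left (by positivity)
  obtain ⟨B, hB, hBN⟩ := hbase
  have hB0 : 0 ≤ B := le_trans (by positivity) hB
  refine ⟨B, hB0, fun k => ?_⟩
  induction k with
  | zero => exact hBN 0 (Nat.zero_le _)
  | succ k ih =>
    rcases lt_or_ge k N with hk | hk
    · exact hBN (k + 1) hk
    obtain ⟨e1, e2, e3⟩ := hN k hk
    push_cast
    set t : ℝ := (k : ℝ) + 1 with ht
    have ht0 : 0 < t := by positivity
    have ht1 : 1 ≤ t := by rw [ht]; linarith [k.cast_nonneg (α := ℝ)]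
    have hstep : u (k + 1) ≤ (1 - c * t ^ (-s)) * (B * t ^ (-r)) + C * t ^ (-(s + r)) :=
      (hu k e3).trans (by gcongr)
    have hsr : t ^ (-(s + r)) = t ^ (-s) * t ^ (-r) := by
      rw [← Real.rpow_add ht0]; congr 1; ring
    have hone : t ^ (-(1 - s)) * t ^ (-s) = t⁻¹ := by
      rw [← Real.rpow_add ht0, ← Real.rpow_neg_one]; congr 1; ring
    -- the decay of `t ^ (-r)` over one unit of time is of the order `t ^ (-r - 1)`
    have hdecay : (1 - t⁻¹) * t ^ (-r) ≤ (t + 1) ^ (-r) := by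
      have e : t + 1 = t * (1 + t⁻¹) := by field_simp
      rw [e, Real.mul_rpow ht0.le (by positivity), mul_comm]
      gcongr
      calc 1 - t⁻¹ ≤ (1 + t⁻¹)⁻¹ := by
            rw [← one_div (1 + t⁻¹), le_div_iff₀ (by positivity)]
            nlinarith [sq_nonneg t⁻¹]
        _ = (1 + t⁻¹) ^ (-1 : ℝ) := (Real.rpow_neg_one _).symm
        _ ≤ (1 + t⁻¹) ^ (-r) :=
            Real.rpow_le_rpow_of_exponent_le (by simp [ht0.le]) (by linarith)
    have hCB : |C| ≤ c / 2 * B := by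
      rw [div_le_iff₀ hc] at hB; linarith
    have hs0 : 0 < t ^ (-s) := by positivity
    have hr0 : 0 < t ^ (-r) := by positivity
    have hkey : B * t⁻¹ + C * t ^ (-s) ≤ c * B * t ^ (-s) := by
      rw [← hone]
      have := mul_le_mul_of_nonneg_left (mul_le_mul_of_nonneg_right e2.le hs0.le) hB0
      nlinarith [mul_le_mul_of_nonneg_right ((le_abs_self C).trans hCB) hs0.le]
    calc u (k + 1) ≤ (1 - c * t ^ (-s)) * (B * t ^ (-r)) + C * t ^ (-(s + r)) := hstep
      _ = (B + (C * t ^ (-s) - c * B * t ^ (-s))) * t ^ (-r) := by rw [hsr]; ring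
      _ ≤ (B - B * t⁻¹) * t ^ (-r) := by gcongr; linarith
      _ = B * ((1 - t⁻¹) * t ^ (-r)) := by ring
      _ ≤ B * (t + 1) ^ (-r) := by gcongr

variable {m n : ℕ} {d : Fin n → ℕ}

/-! ### Relative entropy of joint strategies -/

/-- The relative entropy of joint strategies as a real number. It agrees with `klBar` when the
support of `x` is contained in that of `y`. -/
noncomputable def klReal (x y : Profile d) : ℝ := ∑ p, x p * Real.log (x p / y p)

theorem klReal_eq_sum_block (x y : Profile d) :
    klReal x y = ∑ i, ∑ j, block x i j * Real.log (block x i j / block y i j) :=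
  Fintype.sum_sigma _

/-- The relative entropy dominates a quarter of the squared Euclidean distance. -/
theorem sq_norm_sub_div_four_le_klReal {x y : Profile d}
    (hx : ∀ i, block x i ∈ stdSimplex ℝ (Fin (d i)))
    (hy : ∀ i, block y i ∈ stdSimplex ℝ (Fin (d i))) (h : ∀ p, y p = 0 → x p = 0) :
    ‖x - y‖ ^ 2 / 4 ≤ klReal x y := by
  rw [EuclideanSpace.norm_sq_eq, klReal_eq_sum_block, Fintype.sum_sigma, Finset.sum_div]
  refine Finset.sum_le_sum fun i _ => ?_
  have := sum_sq_sub_div_four_le (hx i) (hy i) fun j => h ⟨i, j⟩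
  rw [Finset.sum_div]
  simpa [block] using this

theorem klBar_eq_ofReal_klReal {x y : Profile d}
    (hx : ∀ i, block x i ∈ stdSimplex ℝ (Fin (d i)))
    (hy : ∀ i, block y i ∈ stdSimplex ℝ (Fin (d i))) (h : ∀ p, y p = 0 → x p = 0) :
    klBar x y = ENNReal.ofReal (klReal x y) := by
  rw [klReal_eq_sum_block, ENNReal.ofReal_sum_of_nonneg]
  · refine Finset.sum_congr rfl fun i _ => ?_
    rw [klDiv]
    exact if_pos fun j => h ⟨i, j⟩
  · intro i _
    exact le_trans (Finset.sum_nonneg fun j _ => by positivity)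
      (sum_sq_sub_div_four_le (hx i) (hy i) fun j => h ⟨i, j⟩)

theorem eq_zero_of_klBar_ne_top {x y : Profile d} (h : klBar x y ≠ ⊤) (p : Σ i, Fin (d i))
    (hp : y p = 0) : x p = 0 := by
  have h1 : klDiv (block x p.1) (block y p.1) ≠ ⊤ := fun h0 =>
    h (ENNReal.sum_eq_top.2 ⟨p.1, Finset.mem_univ _, h0⟩)
  rw [klDiv] at h1
  split_ifs at h1 with h2
  · exact h2 p.2 hp
  · exact absurd rfl h1

/-- Joint convexity of the relative entropy, for mixing both arguments with the uniform
strategies. -/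
theorem klReal_mix_mix_le {x y : Profile d} {w : ℝ} (hw : 0 < w) (hw1 : w ≤ 1)
    (hx : ∀ p, 0 ≤ x p) (hy : ∀ p, 0 ≤ y p) (h : ∀ p, y p = 0 → x p = 0) :
    klReal (mix w x) (mix w y) ≤ (1 - w) * klReal x y := by
  rw [klReal, klReal, Finset.mul_sum]
  refine Finset.sum_le_sum fun p _ => ?_
  have hd : 0 < (d p.1 : ℝ) := by exact_mod_cast p.2.pos
  have h1 : 0 ≤ 1 - w := by linarith
  have := add_mul_log_div_add_le (mul_nonneg h1 (hx p)) (mul_nonneg h1 (hy p))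
    (show 0 < w * (1 / (d p.1 : ℝ)) by positivity) (fun h0 => by
      rcases mul_eq_zero.1 h0 with h0 | h0
      · rw [h0, zero_mul]
      · rw [h p h0, mul_zero])
  refine this.trans_eq ?_
  rcases h1.eq_or_lt with h0 | h0
  · rw [← h0]; simp
  · rw [mul_div_mul_left _ _ h0.ne', mul_assoc]

/-! ### Joint strategies -/

namespace Design

variable {G : Design m n d} {xs : Param m → Profile d} {Hu ρθ ρx : ℝ}

namespace SimplexConstrained

variable (hS : G.SimplexConstrained xs)
include hS

theorem block_mem {x : Profile d} (hx : x ∈ G.profiles) (i : Fin n) :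
    block x i ∈ stdSimplex ℝ (Fin (d i)) := hS.subset_simplex i (hx i)

theorem nonneg {x : Profile d} (hx : x ∈ G.profiles) (p : Σ i, Fin (d i)) : 0 ≤ x p :=
  (hS.block_mem hx p.1).1 p.2

theorem sum_eq_one {x : Profile d} (hx : x ∈ G.profiles) (i : Fin n) : ∑ j, x ⟨i, j⟩ = 1 :=
  (hS.block_mem hx i).2

theorem le_one {x : Profile d} (hx : x ∈ G.profiles) (p : Σ i, Fin (d i)) : x p ≤ 1 := by
  rw [← hS.sum_eq_one hx p.1]
  exact Finset.single_le_sum (f := fun j => x ⟨p.1, j⟩) (fun j _ => hS.nonneg hx _)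
    (Finset.mem_univ p.2)

theorem norm_sub_le {x y : Profile d} (hx : x ∈ G.profiles) (hy : y ∈ G.profiles) :
    ‖x - y‖ ^ 2 ≤ Fintype.card (Σ i, Fin (d i)) := by
  rw [EuclideanSpace.norm_sq_eq]
  refine (Finset.sum_le_card_nsmul _ _ 1 fun p _ => ?_).trans_eq (by simp)
  have h1 := hS.nonneg hx p
  have h2 := hS.nonneg hy p
  have h3 := hS.le_one hx p
  have h4 := hS.le_one hy p
  rw [PiLp.sub_apply, Real.norm_eq_abs, sq_abs]
  nlinarith

theorem mix_mem (hconv : ∀ i, Convex ℝ (G.X i)) {x : Profile d} (hx : x ∈ G.profiles) {w : ℝ}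
    (hw : 0 ≤ w) (hw1 : w ≤ 1) : mix w x ∈ G.profiles := fun i =>
  hconv i (hx i) (hS.uniform_mem i) (sub_nonneg.2 hw1) hw (by ring)

end SimplexConstrained

theorem block_update_mem {x : Profile d} (hx : x ∈ G.profiles) {i : Fin n} {y : Fin (d i) → ℝ}
    (hy : y ∈ G.X i) : ∃ z ∈ G.profiles, block z i = y ∧ ∀ p, p.1 ≠ i → z p = x p := by
  classical
  refine ⟨WithLp.toLp 2 fun p => if h : p.1 = i then y (h ▸ p.2) else x p, fun k => ?_, ?_, ?_⟩
  · by_cases hk : k = i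
    · subst hk
      convert hy using 1
      ext j; simp [block]
    · convert hx k using 1
      ext j; simp [block, hk]
  · ext j; simp [block]
  · intro p hp; simp [hp]

/-- The coordinates in `S` are bounded below by `ε` on all joint strategies, and the equilibria
vanish outside `S`. -/
structure SupportFloor (G : Design m n d) (xs : Param m → Profile d)
    (S : Set (Σ i, Fin (d i))) (ε : ℝ) : Prop where
  pos : 0 < ε
  eq_zero : ∀ θ ∈ G.Θ, ∀ p, p ∉ S → xs θ p = 0
  le : ∀ x ∈ G.profiles, ∀ p ∈ S, ε ≤ x p

namespace GameAssumption

variable (hG : G.GameAssumption xs Hu ρθ ρx)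
include hG

theorem mem {θ : Param m} (hθ : θ ∈ G.Θ) : xs θ ∈ G.profiles := (hG.equilibrium θ hθ).1

/-- Variational stability has a finite right-hand side, so no strategy may vanish where an
equilibrium does not. -/
theorem eq_zero_of_eq_zero {θ : Param m} (hθ : θ ∈ G.Θ) {x : Profile d} (hx : x ∈ G.profiles)
    (p : Σ i, Fin (d i)) (hp : x p = 0) : xs θ p = 0 := by
  refine eq_zero_of_klBar_ne_top (fun htop => ?_) p hp
  have := hG.variationally_stable θ hθ x hx
  rw [htop, EReal.coe_ennreal_top, top_le_iff] at this
  exact EReal.coe_ne_top _ this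

/-- All equilibria have the same support, and the strategies are bounded away from zero on it,
by compactness of the strategy sets. -/
theorem exists_supportFloor (hS : G.SimplexConstrained xs) {θ₀ : Param m} (hθ₀ : θ₀ ∈ G.Θ) :
    ∃ ε, G.SupportFloor xs {p | xs θ₀ p ≠ 0} ε := by
  have hpos : ∀ p : Σ i, Fin (d i), ∃ ε : ℝ, 0 < ε ∧
      (xs θ₀ p ≠ 0 → ∀ x ∈ G.profiles, ε ≤ x p) := by
    intro p
    by_cases hp : xs θ₀ p = 0
    · exact ⟨1, one_pos, fun h => absurd hp h⟩
    obtain ⟨y, hy, hmin⟩ := (hG.compact p.1).exists_isMinOn (hG.nonempty p.1)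
      (continuous_apply p.2).continuousOn
    refine ⟨y p.2, ?_, fun _ x hx => hmin (hx p.1)⟩
    obtain ⟨z, hz, rfl, -⟩ := block_update_mem (hG.mem hθ₀) hy
    exact (hS.nonneg hz p).lt_of_ne' fun h => hp (hG.eq_zero_of_eq_zero hθ₀ hz p h)
  choose ε hε0 hε using hpos
  have hne : (Finset.univ : Finset (Σ i, Fin (d i))).Nonempty ∨ IsEmpty (Σ i, Fin (d i)) := by
    rcases isEmpty_or_nonempty (Σ i, Fin (d i)) with h | h
    · exact Or.inr h
    · exact Or.inl Finset.univ_nonempty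
  rcases hne with hne | hemp
  · refine ⟨Finset.univ.inf' hne ε, (Finset.lt_inf'_iff _).2 fun p _ => hε0 p,
      fun θ hθ p hp => ?_, fun x hx p hp => ?_⟩
    · exact hG.eq_zero_of_eq_zero hθ (hG.mem hθ₀) p (not_not.1 hp)
    · exact (Finset.inf'_le _ (Finset.mem_univ p)).trans (hε p hp x hx)
  · exact ⟨1, one_pos, fun _ _ p => hemp.elim p, fun _ _ p => hemp.elim p⟩

theorem klBar_eq (hS : G.SimplexConstrained xs) {θ : Param m} (hθ : θ ∈ G.Θ) {x : Profile d}
    (hx : x ∈ G.profiles) : klBar (xs θ) x = ENNReal.ofReal (klReal (xs θ) x) :=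
  klBar_eq_ofReal_klReal (hS.block_mem (hG.mem hθ)) (hS.block_mem hx)
    (hG.eq_zero_of_eq_zero hθ hx)

theorem sq_norm_sub_le_klReal (hS : G.SimplexConstrained xs) {θ : Param m} (hθ : θ ∈ G.Θ)
    {x : Profile d} (hx : x ∈ G.profiles) : ‖xs θ - x‖ ^ 2 / 4 ≤ klReal (xs θ) x :=
  sq_norm_sub_div_four_le_klReal (hS.block_mem (hG.mem hθ)) (hS.block_mem hx)
    (hG.eq_zero_of_eq_zero hθ hx)

theorem klReal_nonneg (hS : G.SimplexConstrained xs) {θ : Param m} (hθ : θ ∈ G.Θ)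
    {x : Profile d} (hx : x ∈ G.profiles) : 0 ≤ klReal (xs θ) x :=
  le_trans (by positivity) (hG.sq_norm_sub_le_klReal hS hθ hx)

theorem klReal_le_pairing (hS : G.SimplexConstrained xs) {θ : Param m} (hθ : θ ∈ G.Θ)
    {x : Profile d} (hx : x ∈ G.profiles) : klReal (xs θ) x ≤ G.pairing θ x (xs θ) x := by
  have := hG.variationally_stable θ hθ x hx
  rw [hG.klBar_eq hS hθ hx, EReal.coe_ennreal_ofReal, EReal.coe_le_coe_iff,
    max_eq_left (hG.klReal_nonneg hS hθ hx)] at this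
  exact this

theorem norm_block_sub_sq_le (hS : G.SimplexConstrained xs) {θ : Param m} (hθ : θ ∈ G.Θ)
    {x : Profile d} (hx : x ∈ G.profiles) (i : Fin n) :
    ‖block (G.v θ (xs θ)) i - block (G.v θ x) i‖ ^ 2 ≤ Hu ^ 2 * klReal (xs θ) x := by
  have := hG.lipschitz θ hθ i (xs θ) (hG.mem hθ) x hx
  rw [hG.klBar_eq hS hθ hx, ← ENNReal.ofReal_mul (by positivity)] at this
  exact (ENNReal.ofReal_le_ofReal_iff
    (mul_nonneg (by positivity) (hG.klReal_nonneg hS hθ hx))).1 this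

end GameAssumption

namespace SupportFloor

variable {S : Set (Σ i, Fin (d i))} {ε : ℝ} (hF : G.SupportFloor xs S ε)
include hF

theorem klReal_le (hS : G.SimplexConstrained xs) (hG : G.GameAssumption xs Hu ρθ ρx)
    {θ : Param m} (hθ : θ ∈ G.Θ) {x : Profile d} (hx : x ∈ G.profiles) :
    klReal (xs θ) x ≤ Fintype.card (Σ i, Fin (d i)) / ε := by
  refine (Finset.sum_le_card_nsmul _ _ (1 / ε) fun p _ => ?_).trans_eq
    (by simp [div_eq_mul_inv])
  have hε := hF.pos
  by_cases hp : p ∈ S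
  · have h1 := hF.le _ (hG.mem hθ) p hp
    have h2 := hF.le _ hx p hp
    have h1' := hε.trans_le h1
    have h2' := hε.trans_le h2
    have h3 := hS.le_one (hG.mem hθ) p
    calc xs θ p * Real.log (xs θ p / x p) ≤ xs θ p * (xs θ p / x p) := by
          gcongr
          exact (Real.log_le_sub_one_of_pos (by positivity)).trans (by linarith)
      _ ≤ 1 * (1 / ε) := by gcongr
      _ = 1 / ε := one_mul _
  · rw [hF.eq_zero θ hθ p hp, zero_mul]; positivity

/-- Mixing the second argument with the uniform strategies costs a multiple of the weight. -/
theorem klReal_mix_le (hS : G.SimplexConstrained xs) (hG : G.GameAssumption xs Hu ρθ ρx)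
    {θ : Param m} (hθ : θ ∈ G.Θ) {x : Profile d} (hx : x ∈ G.profiles) {w : ℝ} (hw : 0 ≤ w)
    (hw1 : w ≤ 1) :
    klReal (xs θ) (mix w x) ≤ klReal (xs θ) x
      + w * ∑ p : Σ i, Fin (d i), Real.log (d p.1) := by
  rw [klReal, klReal, Finset.mul_sum, ← Finset.sum_add_distrib]
  refine Finset.sum_le_sum fun p _ => ?_
  have hd : 1 ≤ (d p.1 : ℝ) := by exact_mod_cast p.2.pos
  have hlog := Real.log_nonneg hd
  by_cases hp : p ∈ S
  · have := mul_log_div_mix_le (hS.nonneg (hG.mem hθ) p) (hS.le_one (hG.mem hθ) p)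
      (hF.pos.trans_le (hF.le _ hx p hp)) (hS.le_one hx p) hw hw1
      (show 0 < 1 / (d p.1 : ℝ) by positivity) ((div_le_one (by positivity)).2 hd)
    rw [one_div, Real.log_inv, neg_neg, ← one_div] at this
    exact this
  · rw [hF.eq_zero θ hθ p hp]
    simp only [zero_mul, zero_add]
    positivity

/-- Moving the equilibrium costs a term of second order, up to a small multiple of the
divergence itself. -/
theorem klReal_le_of_move (hS : G.SimplexConstrained xs) (hG : G.GameAssumption xs Hu ρθ ρx)
    {θ θ' : Param m} (hθ : θ ∈ G.Θ) (hθ' : θ' ∈ G.Θ) {x : Profile d} (hx : x ∈ G.profiles)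
    {η : ℝ} (hη : 0 < η) :
    klReal (xs θ') x ≤ (1 + η) * klReal (xs θ) x
      + (1 / (η * ε ^ 2) + 1 / ε) * ‖xs θ' - xs θ‖ ^ 2 := by
  have hε := hF.pos
  have hmass : ∀ t ∈ G.Θ, ∑ p, xs t p = n := fun t ht => by
    rw [Fintype.sum_sigma]
    simp only [hS.sum_eq_one (hG.mem ht)]
    simp
  have hterm : ∀ p, xs θ' p * Real.log (xs θ' p / x p) - xs θ' p
      ≤ xs θ p * Real.log (xs θ p / x p) - xs θ p + η * ((xs θ p - x p) ^ 2 / 4)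
        + (1 / (η * ε ^ 2) + 1 / ε) * (xs θ' p - xs θ p) ^ 2 := by
    intro p
    by_cases hp : p ∈ S
    · refine (mul_log_div_sub_le hε (hF.le _ (hG.mem hθ) p hp) (hF.le _ (hG.mem hθ') p hp)
        (hF.le _ hx p hp)).trans ?_
      have hyoung : |xs θ' p - xs θ p| * |xs θ p - x p| / ε
          ≤ η * (|xs θ p - x p| ^ 2 / 4) + 1 / (η * ε ^ 2) * |xs θ' p - xs θ p| ^ 2 := by
        rw [← sub_nonneg]
        have : η * (|xs θ p - x p| ^ 2 / 4) + 1 / (η * ε ^ 2) * |xs θ' p - xs θ p| ^ 2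
            - |xs θ' p - xs θ p| * |xs θ p - x p| / ε
            = η * (|xs θ p - x p| / 2 - |xs θ' p - xs θ p| / (η * ε)) ^ 2 := by
          field_simp; ring
        rw [this]; positivity
      rw [sq_abs, sq_abs] at hyoung
      have : (xs θ' p - xs θ p) ^ 2 / ε = 1 / ε * (xs θ' p - xs θ p) ^ 2 := by ring
      rw [this, add_mul]
      linarith
    · rw [hF.eq_zero θ hθ p hp, hF.eq_zero θ' hθ' p hp]
      simp only [zero_mul, sub_zero, zero_add, zero_sub]
      positivity
  have hsum := Finset.sum_le_sum fun p (_ : p ∈ Finset.univ) => hterm p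
  simp only [Finset.sum_add_distrib, Finset.sum_sub_distrib, ← Finset.mul_sum,
    ← Finset.sum_div] at hsum
  rw [hmass θ hθ, hmass θ' hθ'] at hsum
  have hn : ∀ y z : Profile d, ‖y - z‖ ^ 2 = ∑ p, (y p - z p) ^ 2 := fun y z => by
    rw [EuclideanSpace.norm_sq_eq]; simp
  have hp := hG.sq_norm_sub_le_klReal hS hθ hx
  rw [hn] at hp ⊢
  have hp' := mul_le_mul_of_nonneg_left hp hη.le
  have e1 : ∀ t, klReal (xs t) x = ∑ p, xs t p * Real.log (xs t p / x p) := fun t => rfl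
  rw [e1] at hp' ⊢
  rw [e1 θ]
  linarith

end SupportFloor

end Design

/-! ### The equilibrium map and the gradient of the reduced objective -/

/-- `h` is a direction of the face of the product of simplices whose relative interior contains
`x`, that is, `h` is in the kernel of `activeMatrix x`. -/
structure IsTangent (x h : Profile d) : Prop where
  eq_zero : ∀ p, x p = 0 → h p = 0
  sum_eq_zero : ∀ i, ∑ j, h ⟨i, j⟩ = 0

namespace Design

theorem activeMatrix_mulVec_eq_zero_iff {x h : Profile d} :
    (activeMatrix x).mulVec h = 0 ↔ IsTangent x h := by
  have h1 : ∀ r, (activeMatrix x).mulVec h (Sum.inl r) = h r.1 := fun r => by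
    simp [activeMatrix, Matrix.mulVec, dotProduct]
  have h2 : ∀ i, (activeMatrix x).mulVec h (Sum.inr i) = ∑ j, h ⟨i, j⟩ := fun i => by
    simp only [activeMatrix, Matrix.mulVec, dotProduct, Matrix.of_apply, Sum.elim_inr, ite_mul,
      one_mul, zero_mul, Fintype.sum_sigma]
    rw [Finset.sum_eq_single i]
    · simp
    · intro k _ hk; simp [hk]
    · simp
  constructor
  · intro h0
    exact ⟨fun p hp => by rw [← h1 ⟨p, hp⟩, h0]; rfl, fun i => by rw [← h2, h0]; rfl⟩
  · intro hh
    ext (r | i)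
    · rw [h1]; exact hh.eq_zero r.1 r.2
    · rw [h2]; exact hh.sum_eq_zero i

open Classical in
theorem activeMatrix_transpose_mulVec (x : Profile d)
    (c : {p : Σ i, Fin (d i) // x p = 0} ⊕ Fin n → ℝ) (p : Σ i, Fin (d i)) :
    (activeMatrix x).transpose.mulVec c p
      = (if h : x p = 0 then c (Sum.inl ⟨p, h⟩) else 0) + c (Sum.inr p.1) := by
  simp only [activeMatrix, Matrix.mulVec, dotProduct, Matrix.transpose_apply, Matrix.of_apply,
    Fintype.sum_sum_type, Sum.elim_inl, Sum.elim_inr, ite_mul, one_mul, zero_mul]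
  congr 1
  · split_ifs with h
    · rw [Finset.sum_eq_single ⟨p, h⟩]
      · simp
      · intro r _ hr
        rw [if_neg fun h0 => hr (Subtype.ext h0)]
      · simp
    · refine Finset.sum_eq_zero fun r _ => if_neg fun h0 : r.1 = p => h (h0 ▸ r.2)
  · simp

variable {G : Design m n d} {xs : Param m → Profile d} {Hu ρθ ρx : ℝ}

theorem pairing_eq_sum (G : Design m n d) (θ : Param m) (x y z : Profile d) :
    G.pairing θ x y z = ∑ p : Σ i, Fin (d i), G.lam p.1 * (G.v θ x p * (y p - z p)) := by
  simp only [pairing, Fintype.sum_sigma, Finset.mul_sum, block]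

theorem toEuclideanCLM_jacX (G : Design m n d) (θ : Param m) (x : Profile d) :
    Matrix.toEuclideanCLM (𝕜 := ℝ) (G.jacX θ x) = fderiv ℝ (G.v θ) x := by
  refine ContinuousLinearMap.coe_injective
    ((EuclideanSpace.basisFun (Σ i, Fin (d i)) ℝ).toBasis.ext fun q => ?_)
  ext p
  simp [jacX, Matrix.mulVec_single]

theorem jacX_mulVec (G : Design m n d) (θ : Param m) (x h : Profile d) :
    (G.jacX θ x).mulVec h = fderiv ℝ (G.v θ) x h := by
  rw [← toEuclideanCLM_jacX]; rfl

namespace GameAssumption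

variable (hG : G.GameAssumption xs Hu ρθ ρx)
include hG

theorem sum_lam_mul_le (w h : Profile d) :
    ∑ p : Σ i, Fin (d i), G.lam p.1 * (w p * h p) ≤ (∑ i, G.lam i) * (‖w‖ * ‖h‖) := by
  have hΛ : 0 ≤ ∑ i, G.lam i := Finset.sum_nonneg fun i _ => (hG.lam_pos i).le
  have h1 : ∀ p : Σ i, Fin (d i), G.lam p.1 * (w p * h p) ≤ (∑ i, G.lam i) * (|w p| * |h p|) := by
    intro p
    rw [← abs_mul]
    exact (mul_le_mul_of_nonneg_left (le_abs_self _) (hG.lam_pos _).le).trans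
      (mul_le_mul_of_nonneg_right (Finset.single_le_sum (fun i _ => (hG.lam_pos i).le)
        (Finset.mem_univ _)) (abs_nonneg _))
  refine (Finset.sum_le_sum fun p _ => h1 p).trans ?_
  rw [← Finset.mul_sum]
  refine mul_le_mul_of_nonneg_left ?_ hΛ
  rw [EuclideanSpace.norm_eq, EuclideanSpace.norm_eq]
  simpa using Real.sum_mul_le_sqrt_mul_sqrt Finset.univ (fun p => |w p|) fun p => |h p|

theorem norm_sub_le_of_equilibrium (hS : G.SimplexConstrained xs) (hΘ : Convex ℝ G.Θ)
    {θ θ' : Param m} (hθ : θ ∈ G.Θ) (hθ' : θ' ∈ G.Θ) :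
    ‖xs θ' - xs θ‖ ≤ 4 * (∑ i, G.lam i) * ρθ * ‖θ' - θ‖ := by
  have hx' := hG.mem hθ'
  have h1 := (hG.sq_norm_sub_le_klReal hS hθ hx').trans (hG.klReal_le_pairing hS hθ hx')
  have h2 := (hG.equilibrium θ' hθ').2 (xs θ) (hG.mem hθ)
  rw [pairing_eq_sum] at h1 h2
  have h3 : ‖G.v θ' (xs θ') - G.v θ (xs θ')‖ ≤ ρθ * ‖θ' - θ‖ := by
    refine hΘ.norm_image_sub_le_of_norm_hasFDerivWithin_le (f := fun t => G.v t (xs θ'))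
      (f' := fun t => G.jacTheta t (xs θ')) (fun t ht => ?_)
      (fun t ht => (hG.jacTheta_bound t ht _ hx').le) hθ hθ'
    have hd := hG.differentiable t ht _ hx'
    have : DifferentiableAt ℝ (fun s => G.v s (xs θ')) t :=
      DifferentiableAt.comp (g := fun z : Param m × Profile d => G.v z.1 z.2)
        (f := fun s => (s, xs θ')) t hd (differentiableAt_id.prodMk (differentiableAt_const _))
    exact this.hasFDerivAt.hasFDerivWithinAt
  have h4 := hG.sum_lam_mul_le (G.v θ (xs θ') - G.v θ' (xs θ')) (xs θ - xs θ')
  simp only [PiLp.sub_apply, sub_mul, mul_sub, Finset.sum_sub_distrib] at h1 h2 h4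
  rw [norm_sub_rev] at h3
  have hΛ : 0 ≤ ∑ i, G.lam i := Finset.sum_nonneg fun i _ => (hG.lam_pos i).le
  have h5 : ‖xs θ - xs θ'‖ ^ 2 / 4
      ≤ (∑ i, G.lam i) * ((ρθ * ‖θ' - θ‖) * ‖xs θ - xs θ'‖) := by
    refine le_trans ?_ (mul_le_mul_of_nonneg_left
      (mul_le_mul_of_nonneg_right h3 (norm_nonneg _)) hΛ)
    linarith
  rw [norm_sub_rev]
  rcases (norm_nonneg (xs θ - xs θ')).eq_or_lt with h0 | h0
  · rw [← h0]; have := hG.ρθ_pos; positivity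
  · refine le_of_mul_le_mul_right ?_ h0
    nlinarith

theorem eq_zero_iff {θ θ' : Param m} (hθ : θ ∈ G.Θ) (hθ' : θ' ∈ G.Θ) (p : Σ i, Fin (d i)) :
    xs θ' p = 0 ↔ xs θ p = 0 :=
  ⟨hG.eq_zero_of_eq_zero hθ (hG.mem hθ') p, hG.eq_zero_of_eq_zero hθ' (hG.mem hθ) p⟩

theorem isTangent_sub (hS : G.SimplexConstrained xs) {θ θ' : Param m} (hθ : θ ∈ G.Θ)
    (hθ' : θ' ∈ G.Θ) : IsTangent (xs θ) (xs θ' - xs θ) where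
  eq_zero p hp := by rw [PiLp.sub_apply, hp, (hG.eq_zero_iff hθ hθ' p).2 hp, sub_zero]
  sum_eq_zero i := by
    simp only [PiLp.sub_apply, Finset.sum_sub_distrib]
    rw [hS.sum_eq_one (hG.mem hθ), hS.sum_eq_one (hG.mem hθ'), sub_self]

/-- An equilibrium can be moved a little in every direction of its face. -/
theorem eventually_add_smul_mem (hS : G.SimplexConstrained xs) {θ : Param m} (hθ : θ ∈ G.Θ)
    {h : Profile d} (hh : IsTangent (xs θ) h) : ∀ᶠ t in 𝓝[>] (0 : ℝ), xs θ + t • h ∈ G.profiles := by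
  have hcont : ∀ p, Tendsto (fun t : ℝ => (xs θ + t • h) p) (𝓝[>] 0) (𝓝 (xs θ p)) := by
    intro p
    have : Continuous fun t : ℝ => xs θ p + t * h p := by fun_prop
    have := (this.tendsto 0).mono_left (nhdsWithin_le_nhds (s := Set.Ioi 0))
    simpa using this
  have hnn : ∀ p, ∀ᶠ t in 𝓝[>] (0 : ℝ), 0 ≤ (xs θ + t • h) p := by
    intro p
    rcases (hS.nonneg (hG.mem hθ) p).eq_or_lt with h0 | h0
    · refine Eventually.of_forall fun t => ?_
      simp [← h0, hh.eq_zero p h0.symm]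
    · exact ((hcont p).eventually_const_lt h0).mono fun t ht => ht.le
  refine eventually_all.2 fun i => ?_
  have htend : Tendsto (fun t : ℝ => block (xs θ + t • h) i) (𝓝[>] 0)
      (𝓝[stdSimplex ℝ (Fin (d i))] (block (xs θ) i)) := by
    refine tendsto_nhdsWithin_iff.2 ⟨tendsto_pi_nhds.2 fun j => hcont ⟨i, j⟩, ?_⟩
    filter_upwards [eventually_all.2 hnn] with t ht
    refine ⟨fun j => ht ⟨i, j⟩, ?_⟩
    simp only [block, PiLp.add_apply, PiLp.smul_apply, smul_eq_mul, Finset.sum_add_distrib,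
      ← Finset.mul_sum]
    rw [hh.sum_eq_zero i, hS.sum_eq_one (hG.mem hθ)]
    simp
  exact htend.eventually (hS.nhds_equilibrium θ hθ i)

/-- At an equilibrium, the payoff gradient of an agent is constant on the support. -/
theorem exists_eq_on_support (hS : G.SimplexConstrained xs) {θ : Param m} (hθ : θ ∈ G.Θ) :
    ∃ c : Fin n → ℝ, ∀ p, xs θ p ≠ 0 → G.v θ (xs θ) p = c p.1 := by
  classical
  have hle : ∀ i j l, xs θ ⟨i, j⟩ ≠ 0 → xs θ ⟨i, l⟩ ≠ 0 →
      G.v θ (xs θ) ⟨i, j⟩ ≤ G.v θ (xs θ) ⟨i, l⟩ := by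
    intro i j l hj hl
    -- shift mass from the pure strategy `l` to the pure strategy `j`
    set h : Profile d := EuclideanSpace.single ⟨i, j⟩ 1 - EuclideanSpace.single ⟨i, l⟩ 1 with hdef
    have hh : IsTangent (xs θ) h := by
      refine ⟨fun p hp => ?_, fun k => ?_⟩
      · have h1 : p ≠ ⟨i, j⟩ := fun h0 => hj (h0 ▸ hp)
        have h2 : p ≠ ⟨i, l⟩ := fun h0 => hl (h0 ▸ hp)
        simp [hdef, h1, h2]
      · by_cases hk : k = i
        · subst hk; simp [hdef]
        · simp [hdef, hk]
    obtain ⟨t, ht, ht0⟩ := ((hG.eventually_add_smul_mem hS hθ hh).and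
      self_mem_nhdsWithin).exists
    have hpair := (hG.equilibrium θ hθ).2 _ ht
    rw [pairing_eq_sum] at hpair
    have hsum : ∑ p : Σ i, Fin (d i), G.lam p.1 * (G.v θ (xs θ) p * ((xs θ + t • h) p - xs θ p))
        = G.lam i * t * (G.v θ (xs θ) ⟨i, j⟩ - G.v θ (xs θ) ⟨i, l⟩) := by
      have e : ∀ p : Σ i, Fin (d i),
          G.lam p.1 * (G.v θ (xs θ) p * ((xs θ + t • h) p - xs θ p))
            = (if p = ⟨i, j⟩ then G.lam p.1 * t * G.v θ (xs θ) p else 0)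
              - (if p = ⟨i, l⟩ then G.lam p.1 * t * G.v θ (xs θ) p else 0) := fun p => by
        simp only [hdef, PiLp.add_apply, PiLp.smul_apply, PiLp.sub_apply,
          PiLp.single_apply, smul_eq_mul]
        split_ifs <;> ring
      rw [Finset.sum_congr rfl fun p _ => e p, Finset.sum_sub_distrib, Finset.sum_ite_eq',
        Finset.sum_ite_eq', if_pos (Finset.mem_univ _), if_pos (Finset.mem_univ _)]
      ring
    rw [hsum] at hpair
    have hpos : 0 < G.lam i * t := mul_pos (hG.lam_pos i) ht0
    nlinarith
  have hex : ∀ i, ∃ j, xs θ ⟨i, j⟩ ≠ 0 := fun i => by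
    by_contra! h0
    have := hS.sum_eq_one (hG.mem hθ) i
    simp [h0] at this
  choose j hj using hex
  refine ⟨fun i => G.v θ (xs θ) ⟨i, j i⟩, fun p hp => ?_⟩
  exact le_antisymm (hle p.1 p.2 _ hp (hj _)) (hle p.1 _ p.2 (hj _) hp)

theorem differentiableAt_profile {θ : Param m} (hθ : θ ∈ G.Θ) {x : Profile d}
    (hx : x ∈ G.profiles) : DifferentiableAt ℝ (G.v θ) x :=
  DifferentiableAt.comp (g := fun z : Param m × Profile d => G.v z.1 z.2) x
    (hG.differentiable θ hθ x hx) ((differentiableAt_const _).prodMk differentiableAt_id)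

/-- Variational stability makes the weighted Jacobian negative definite on the face of the
equilibrium. -/
theorem sum_lam_mul_fderiv_le (hS : G.SimplexConstrained xs) {θ : Param m} (hθ : θ ∈ G.Θ)
    {h : Profile d} (hh : IsTangent (xs θ) h) :
    ∑ p : Σ i, Fin (d i), G.lam p.1 * (fderiv ℝ (G.v θ) (xs θ) h p * h p) ≤ -(‖h‖ ^ 2 / 4) := by
  obtain ⟨c, hc⟩ := hG.exists_eq_on_support hS hθ
  have hzero : ∑ p : Σ i, Fin (d i), G.lam p.1 * (G.v θ (xs θ) p * h p) = 0 := by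
    have e : ∀ p : Σ i, Fin (d i), G.lam p.1 * (G.v θ (xs θ) p * h p)
        = G.lam p.1 * c p.1 * h p := fun p => by
      by_cases hp : xs θ p = 0
      · rw [hh.eq_zero p hp]; ring
      · rw [hc p hp]; ring
    rw [Finset.sum_congr rfl fun p _ => e p, Fintype.sum_sigma]
    refine Finset.sum_eq_zero fun i _ => ?_
    simp only [← Finset.mul_sum]
    rw [hh.sum_eq_zero i, mul_zero]
  have hderiv : HasDerivAt (fun t : ℝ => G.v θ (xs θ + t • h)) (fderiv ℝ (G.v θ) (xs θ) h) 0 := by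
    have h1 : HasDerivAt (fun t : ℝ => xs θ + t • h) h 0 := by
      simpa using ((hasDerivAt_id (0 : ℝ)).smul_const h).const_add (xs θ)
    have h2 : HasFDerivAt (G.v θ) (fderiv ℝ (G.v θ) (xs θ)) (xs θ + (0 : ℝ) • h) := by
      rw [zero_smul, add_zero]
      exact (hG.differentiableAt_profile hθ (hG.mem hθ)).hasFDerivAt
    exact h2.comp_hasDerivAt 0 h1
  have hlim := hderiv.tendsto_slope_zero_right
  simp only [zero_add, zero_smul, add_zero] at hlim
  have hlim2 : Tendsto (fun t : ℝ => ∑ p : Σ i, Fin (d i), G.lam p.1 *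
      ((t⁻¹ • (G.v θ (xs θ + t • h) - G.v θ (xs θ))) p * h p)) (𝓝[>] 0)
      (𝓝 (∑ p : Σ i, Fin (d i), G.lam p.1 * (fderiv ℝ (G.v θ) (xs θ) h p * h p))) := by
    refine tendsto_finsetSum _ fun p _ => Tendsto.const_mul _ (Tendsto.mul_const _ ?_)
    exact ((EuclideanSpace.proj p).continuous.tendsto _).comp hlim
  refine le_of_tendsto hlim2 ?_
  filter_upwards [hG.eventually_add_smul_mem hS hθ hh, self_mem_nhdsWithin] with t ht ht0
  have ht0 : 0 < t := ht0
  have h1 := (hG.sq_norm_sub_le_klReal hS hθ ht).trans (hG.klReal_le_pairing hS hθ ht)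
  rw [pairing_eq_sum, sub_add_cancel_left, norm_neg, norm_smul, mul_pow, Real.norm_eq_abs,
    sq_abs] at h1
  have h2 : ∑ p : Σ i, Fin (d i), G.lam p.1 *
      (G.v θ (xs θ + t • h) p * (xs θ p - (xs θ + t • h) p))
      = -(t ^ 2 * ∑ p : Σ i, Fin (d i), G.lam p.1 *
      ((t⁻¹ • (G.v θ (xs θ + t • h) - G.v θ (xs θ))) p * h p))
      - t * ∑ p : Σ i, Fin (d i), G.lam p.1 * (G.v θ (xs θ) p * h p) := by
    rw [Finset.mul_sum, Finset.mul_sum, ← Finset.sum_neg_distrib, ← Finset.sum_sub_distrib]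
    refine Finset.sum_congr rfl fun p _ => ?_
    simp only [PiLp.add_apply, PiLp.smul_apply, PiLp.sub_apply, smul_eq_mul]
    field_simp; ring
  rw [h2, hzero] at h1
  have ht2 : 0 < t ^ 2 := by positivity
  refine le_of_mul_le_mul_left ?_ ht2
  linarith

open Classical in
/-- The Schur complement in the sensitivity matrix is invertible. -/
theorem isUnit_schur (hS : G.SimplexConstrained xs) {θ : Param m} (hθ : θ ∈ G.Θ) :
    IsUnit (activeMatrix (xs θ) * (G.jacX θ (xs θ))⁻¹ * (activeMatrix (xs θ)).transpose).det := by
  have hdet := hG.jacX_invertible θ hθ _ (hG.mem hθ)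
  rw [← Matrix.isUnit_iff_isUnit_det, ← Matrix.mulVec_injective_iff_isUnit]
  intro c₁ c₂ hc
  rw [← sub_eq_zero] at hc ⊢
  simp only at hc
  rw [← Matrix.mulVec_sub] at hc
  generalize c₁ - c₂ = c at hc
  set w := (activeMatrix (xs θ)).transpose.mulVec c with hw
  set h : Profile d := WithLp.toLp 2 ((G.jacX θ (xs θ))⁻¹.mulVec w) with hh
  rw [← Matrix.mulVec_mulVec, ← Matrix.mulVec_mulVec] at hc
  have htan : IsTangent (xs θ) h := activeMatrix_mulVec_eq_zero_iff.1 hc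
  have hMh : ⇑(fderiv ℝ (G.v θ) (xs θ) h) = w := by
    rw [← jacX_mulVec, hh]
    simp only
    rw [Matrix.mulVec_mulVec, Matrix.mul_nonsing_inv _ hdet, Matrix.one_mulVec]
  have hneg := hG.sum_lam_mul_fderiv_le hS hθ htan
  have hzero : ∑ p : Σ i, Fin (d i), G.lam p.1 * (fderiv ℝ (G.v θ) (xs θ) h p * h p) = 0 := by
    have e : ∀ p : Σ i, Fin (d i), G.lam p.1 * (fderiv ℝ (G.v θ) (xs θ) h p * h p)
        = G.lam p.1 * c (Sum.inr p.1) * h p := fun p => by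
      by_cases hp : xs θ p = 0
      · rw [htan.eq_zero p hp]; ring
      · rw [hMh, hw, activeMatrix_transpose_mulVec, dif_neg hp]; ring
    rw [Finset.sum_congr rfl fun p _ => e p, Fintype.sum_sigma]
    refine Finset.sum_eq_zero fun i _ => ?_
    simp only [← Finset.mul_sum]
    rw [htan.sum_eq_zero i, mul_zero]
  rw [hzero] at hneg
  have hh0 : h = 0 := norm_eq_zero.1 (pow_eq_zero_iff two_ne_zero |>.1
    (le_antisymm (by linarith) (sq_nonneg ‖h‖)))
  rw [hh0, map_zero] at hMh
  have hcw : ∀ p, (activeMatrix (xs θ)).transpose.mulVec c p = 0 := fun p => by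
    rw [← hw, ← hMh]; rfl
  have hr : ∀ i, c (Sum.inr i) = 0 := fun i => by
    obtain ⟨j, hj⟩ : ∃ j, xs θ ⟨i, j⟩ ≠ 0 := by
      by_contra! h0
      have := hS.sum_eq_one (hG.mem hθ) i
      simp [h0] at this
    have := hcw ⟨i, j⟩
    rwa [activeMatrix_transpose_mulVec, dif_neg hj, zero_add] at this
  ext (r | i)
  · have := hcw r.1
    rwa [activeMatrix_transpose_mulVec, dif_pos r.2, hr, add_zero] at this
  · exact hr i

open Classical in
/-- The sensitivity matrix annihilates the vectors that are constant, for every agent, on the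
support of the equilibrium. -/
theorem sensMatrix_mulVec_eq_zero (hS : G.SimplexConstrained xs) {θ : Param m} (hθ : θ ∈ G.Θ)
    {w : Profile d} {c : Fin n → ℝ} (hw : ∀ p, xs θ p ≠ 0 → w p = c p.1) :
    (G.sensMatrix θ (xs θ)).mulVec w = 0 := by
  have hw' : ⇑w = (activeMatrix (xs θ)).transpose.mulVec
      (Sum.elim (fun r => w r.1 - c r.1.1) c) := by
    ext p
    rw [activeMatrix_transpose_mulVec]
    split_ifs with h
    · simp
    · simp [hw p h]
  rw [hw', Matrix.mulVec_mulVec]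
  have h0 : G.sensMatrix θ (xs θ) * (activeMatrix (xs θ)).transpose = 0 := by
    have hu := Matrix.nonsing_inv_mul _ (hG.isUnit_schur hS hθ)
    simp only [sensMatrix]
    rw [Matrix.sub_mul, sub_eq_zero]
    conv_lhs => rw [← Matrix.mul_one (_ * (activeMatrix (xs θ)).transpose), ← hu]
    simp only [Matrix.mul_assoc]
  rw [h0, Matrix.zero_mulVec]

/-- On the face of the equilibrium, the sensitivity matrix inverts the Jacobian. -/
theorem sensMatrix_mulVec_fderiv {θ : Param m} (hθ : θ ∈ G.Θ)
    {h : Profile d} (hh : IsTangent (xs θ) h) :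
    (G.sensMatrix θ (xs θ)).mulVec (fderiv ℝ (G.v θ) (xs θ) h) = h := by
  classical
  have hdet := hG.jacX_invertible θ hθ _ (hG.mem hθ)
  rw [← jacX_mulVec, Matrix.mulVec_mulVec]
  simp only [sensMatrix]
  rw [Matrix.sub_mul, Matrix.mul_assoc _ _ (G.jacX θ (xs θ)), Matrix.nonsing_inv_mul _ hdet,
    Matrix.mul_one, Matrix.sub_mulVec, Matrix.one_mulVec, ← Matrix.mulVec_mulVec,
    activeMatrix_mulVec_eq_zero_iff.2 hh, Matrix.mulVec_zero, sub_zero]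

/-- The equilibrium map is differentiable on `Θ`, with the derivative given by the sensitivity
matrix: the payoff gradient stays constant on the support along the equilibria, so its total
derivative is annihilated by the sensitivity matrix. -/
theorem hasFDerivWithinAt_equilibrium (hS : G.SimplexConstrained xs) (hΘ : Convex ℝ G.Θ)
    {θ : Param m} (hθ : θ ∈ G.Θ) :
    HasFDerivWithinAt xs
      (-((Matrix.toEuclideanCLM (𝕜 := ℝ) (G.sensMatrix θ (xs θ))).comp (G.jacTheta θ (xs θ))))
      G.Θ θ := by
  set J := Matrix.toEuclideanCLM (𝕜 := ℝ) (G.sensMatrix θ (xs θ)) with hJ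
  set F := fun z : Param m × Profile d => G.v z.1 z.2 with hFdef
  have hF : HasFDerivAt F (fderiv ℝ F (θ, xs θ)) (θ, xs θ) :=
    (hG.differentiable θ hθ _ (hG.mem hθ)).hasFDerivAt
  have hFθ : ∀ δ, fderiv ℝ F (θ, xs θ) (δ, 0) = G.jacTheta θ (xs θ) δ := fun δ => by
    have h1 : HasFDerivAt (fun t => F (t, xs θ)) _ θ :=
      HasFDerivAt.comp (f := fun t : Param m => (t, xs θ)) θ hF
        ((hasFDerivAt_id θ).prodMk (hasFDerivAt_const _ _))
    rw [jacTheta, show (fun t => G.v t (xs θ)) = fun t => F (t, xs θ) from rfl, h1.fderiv]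
    simp
  have hFx : ∀ h, fderiv ℝ F (θ, xs θ) (0, h) = fderiv ℝ (G.v θ) (xs θ) h := fun h => by
    have h1 : HasFDerivAt (fun y => F (θ, y)) _ (xs θ) :=
      HasFDerivAt.comp (f := fun y : Profile d => (θ, y)) (xs θ) hF
        ((hasFDerivAt_const _ _).prodMk (hasFDerivAt_id (xs θ)))
    rw [show G.v θ = fun y => F (θ, y) from rfl, h1.fderiv]
    simp
  -- the equilibrium map is Lipschitz
  have hlip : (fun t => xs t - xs θ) =O[𝓝[G.Θ] θ] fun t => t - θ :=
    Asymptotics.IsBigO.of_bound (4 * (∑ i, G.lam i) * ρθ) (by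
      filter_upwards [self_mem_nhdsWithin] with t ht
      exact hG.norm_sub_le_of_equilibrium hS hΘ hθ ht)
  have htend : Tendsto (fun t => (t, xs t)) (𝓝[G.Θ] θ) (𝓝 (θ, xs θ)) := by
    refine (tendsto_id.mono_left nhdsWithin_le_nhds).prodMk_nhds ?_
    rw [← tendsto_sub_nhds_zero_iff]
    refine hlip.trans_tendsto ?_
    rw [tendsto_sub_nhds_zero_iff]
    exact tendsto_id.mono_left nhdsWithin_le_nhds
  have hrem : (fun t => F (t, xs t) - F (θ, xs θ) - fderiv ℝ F (θ, xs θ) ((t, xs t) - (θ, xs θ)))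
      =o[𝓝[G.Θ] θ] fun t => t - θ :=
    (hF.isLittleO.comp_tendsto htend).trans_isBigO
      ((Asymptotics.isBigO_refl _ _).prod_left hlip)
  have hJrem := (J.isBigO_comp _ _).trans_isLittleO hrem
  refine hasFDerivWithinAt_iff_isLittleO.2 ?_
  refine (hJrem.neg_left).congr' ?_ EventuallyEq.rfl
  filter_upwards [self_mem_nhdsWithin] with t ht
  obtain ⟨c, hc⟩ := hG.exists_eq_on_support hS hθ
  obtain ⟨c', hc'⟩ := hG.exists_eq_on_support hS ht
  have hJv : J (F (t, xs t) - F (θ, xs θ)) = 0 := by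
    have := hG.sensMatrix_mulVec_eq_zero hS hθ (w := F (t, xs t) - F (θ, xs θ)) (c := c' - c)
      fun p hp => by
        rw [PiLp.sub_apply, Pi.sub_apply, hc p hp, hc' p fun h => hp ((hG.eq_zero_iff hθ ht p).1 h)]
    ext p
    exact congrFun this p
  have hJx : J (fderiv ℝ (G.v θ) (xs θ) (xs t - xs θ)) = xs t - xs θ := by
    ext p
    exact congrFun (hG.sensMatrix_mulVec_fderiv hθ (hG.isTangent_sub hS hθ ht)) p
  have hsplit : ((t, xs t) - (θ, xs θ) : Param m × Profile d)
      = (t - θ, 0) + (0, xs t - xs θ) := by simp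
  rw [hsplit, map_add, hFθ, hFx, map_sub, map_add, hJv, hJx]
  simp
  abel

/-- The extended gradient at the equilibrium is a gradient of the reduced objective. -/
theorem hasGradientWithinAt_reduced (hS : G.SimplexConstrained xs) (hΘ : Convex ℝ G.Θ)
    {Jhat : Param m → Profile d → Matrix (Σ i, Fin (d i)) (Σ i, Fin (d i)) ℝ}
    {θ : Param m} (hθ : θ ∈ G.Θ) (hJ : Jhat θ (xs θ) = G.sensMatrix θ (xs θ))
    (hf : DifferentiableAt ℝ (fun z : Param m × Profile d => G.f z.1 z.2) (θ, xs θ)) :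
    HasGradientWithinAt (G.reduced xs) (G.extGrad Jhat θ (xs θ)) G.Θ θ := by
  set F := fun z : Param m × Profile d => G.f z.1 z.2 with hFdef
  have hF := hf.hasFDerivAt
  have h1 : HasFDerivAt (fun t => F (t, xs θ)) _ θ :=
    HasFDerivAt.comp (f := fun t : Param m => (t, xs θ)) θ hF
      ((hasFDerivAt_id θ).prodMk (hasFDerivAt_const _ _))
  have h2 : HasFDerivAt (fun y => F (θ, y)) _ (xs θ) :=
    HasFDerivAt.comp (f := fun y : Profile d => (θ, y)) (xs θ) hF
      ((hasFDerivAt_const _ _).prodMk (hasFDerivAt_id (xs θ)))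
  have h3 : HasFDerivWithinAt (G.reduced xs) _ G.Θ θ :=
    HasFDerivAt.comp_hasFDerivWithinAt (f := fun t => (t, xs t)) θ hF
      ((hasFDerivWithinAt_id θ G.Θ).prodMk (hG.hasFDerivWithinAt_equilibrium hS hΘ hθ))
  rw [hasGradientWithinAt_iff_hasFDerivWithinAt]
  refine h3.congr_fderiv (Eq.symm ?_)
  ext1 δ
  have hadj : Matrix.toEuclideanCLM (𝕜 := ℝ) (G.sensMatrix θ (xs θ)).transpose
      = (Matrix.toEuclideanCLM (𝕜 := ℝ) (G.sensMatrix θ (xs θ))).adjoint := by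
    rw [← ContinuousLinearMap.star_eq_adjoint, ← map_star]
    rfl
  simp only [InnerProductSpace.toDual_apply_apply, extGrad, hJ, inner_sub_left]
  rw [ContinuousLinearMap.adjoint_inner_left, hadj, ContinuousLinearMap.adjoint_inner_left,
    inner_gradient_left, inner_gradient_left,
    show (fun t => G.f t (xs θ)) = fun t => F (t, xs θ) from rfl, h1.fderiv,
    show G.f θ = fun y => F (θ, y) from rfl, h2.fderiv]
  simp only [ContinuousLinearMap.comp_apply, ContinuousLinearMap.prod_apply,
    ContinuousLinearMap.id_apply, zero_apply, neg_apply]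
  rw [← map_sub, Prod.mk_sub_mk, sub_zero, zero_sub]

/-- Along `Θ`, the extended gradient at the equilibrium acts as any gradient of the reduced
objective. -/
theorem inner_extGrad_eq (hS : G.SimplexConstrained xs)
    {Jhat : Param m → Profile d → Matrix (Σ i, Fin (d i)) (Σ i, Fin (d i)) ℝ}
    {gradF : Param m → Param m} {μ M Ht : ℝ} (hO : G.ObjectiveAssumption xs Jhat gradF μ M Ht)
    {θ θ' : Param m} (hθ : θ ∈ G.Θ) (hθ' : θ' ∈ G.Θ) :
    ⟪G.extGrad Jhat θ (xs θ), θ' - θ⟫ = ⟪gradF θ, θ' - θ⟫ := by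
  have h1 := (hG.hasGradientWithinAt_reduced hS hO.convex hθ (hO.exact_at_equilibrium θ hθ)
    (hO.differentiable θ hθ _ (hG.mem hθ))).hasFDerivWithinAt
  have h2 := (hO.hasGradient θ hθ).hasFDerivWithinAt
  have h3 := h1.unique_on h2 (mem_tangentConeAt_of_segment_subset
    (hO.convex.segment_subset hθ hθ'))
  simpa using h3

end GameAssumption
end Design

/-! ### One step of the agents and of the designer -/

/-- The three-point inequality of a projected gradient step. -/
theorem projected_three_point {E : Type*} [NormedAddCommGroup E] [InnerProductSpace ℝ E]
    {s : Set E} (hs : Convex ℝ s) {a : ℝ} (ha : 0 < a) {g t t' u : E} (ht' : t' ∈ s)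
    (hu : u ∈ s) (hmax : IsMaxOn (fun y => -⟪g, y⟫ - 1 / a * ‖y - t‖ ^ 2) s t') :
    ‖t' - u‖ ^ 2 ≤ ‖t - u‖ ^ 2 - ‖t' - t‖ ^ 2 + a * ⟪g, u - t'⟫ := by
  have hfirst : -(2 * ⟪t' - t, u - t'⟫) ≤ a * ⟪g, u - t'⟫ := by
    refine le_of_forall_le_add_mul (C := ‖u - t'‖ ^ 2) fun r hr hr1 => ?_
    have hopt := hmax (hs.add_smul_sub_mem ht' hu ⟨hr.le, hr1⟩)
    simp only [Set.mem_ofPred_eq] at hopt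
    rw [add_sub_right_comm, norm_add_sq_real, inner_add_right, inner_smul_right,
      inner_smul_right, norm_smul, mul_pow, Real.norm_eq_abs, sq_abs] at hopt
    have hopt' := mul_le_mul_of_nonneg_left hopt ha.le
    have hcc : a * (1 / a) = 1 := by field_simp
    rw [mul_sub, mul_sub, ← mul_assoc a (1 / a), ← mul_assoc a (1 / a), hcc] at hopt'
    refine le_of_mul_le_mul_left ?_ hr
    linarith
  have hexp : ‖t - u‖ ^ 2 = ‖t' - u‖ ^ 2 + 2 * ⟪t' - t, u - t'⟫ + ‖t' - t‖ ^ 2 := by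
    have e : t - u = (t' - u) - (t' - t) := by abel
    rw [e, norm_sub_sq_real, real_inner_comm, ← neg_sub u t', inner_neg_right]
    ring
  linarith

namespace Design

variable {G : Design m n d} {xs : Param m → Profile d} {Hu ρθ ρx : ℝ}
  {S : Set (Σ i, Fin (d i))} {ε : ℝ}

/-- One step of the agents, from a fully mixed strategy `w` to `z`. -/
theorem GameAssumption.klReal_le_of_step (hG : G.GameAssumption xs Hu ρθ ρx)
    (hS : G.SimplexConstrained xs) {θ : Param m} (hθ : θ ∈ G.Θ) {b : ℝ} (hb : 0 < b)
    (g : Profile d) {w z : Profile d} (hw : w ∈ G.profiles) (hw0 : ∀ p, 0 < w p)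
    (hz : z ∈ G.profiles)
    (hmax : ∀ i, IsMaxOn
      (fun y : Fin (d i) → ℝ => ((∑ j, block g i j * y j : ℝ) : EReal)
        - ((1 / (G.lam i * b) : ℝ) : EReal) * ((klDiv y (block w i) : ℝ≥0∞) : EReal))
      (G.X i) (block z i)) :
    klReal (xs θ) z ≤ (1 - b) * klReal (xs θ) w
      + b * ∑ p : Σ i, Fin (d i), G.lam p.1 * ((g - G.v θ w) p * (w p - xs θ p))
      + b ^ 2 * (∑ i, G.lam i) ^ 2 * ‖g‖ ^ 2 := by
  have hval : ∀ i, ∀ y ∈ G.X i, ((∑ j, block g i j * y j : ℝ) : EReal)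
        - ((1 / (G.lam i * b) : ℝ) : EReal) * ((klDiv y (block w i) : ℝ≥0∞) : EReal)
      = ((∑ j, block g i j * y j
          - 1 / (G.lam i * b) * ∑ j, y j * Real.log (y j / block w i j) : ℝ) : EReal) := by
    intro i y hy
    have hne : ∀ j, block w i j = 0 → y j = 0 := fun j h => absurd h (hw0 ⟨i, j⟩).ne'
    have hnn := le_trans (Finset.sum_nonneg fun j _ => by positivity)
      (sum_sq_sub_div_four_le (hS.subset_simplex i hy) (hS.block_mem hw i) hne)
    rw [klDiv, if_pos hne, EReal.coe_ennreal_ofReal, max_eq_left hnn]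
    norm_cast
  have hstep : ∀ i, ∑ j, block (xs θ) i j * Real.log (block (xs θ) i j / block z i j)
      ≤ ∑ j, block (xs θ) i j * Real.log (block (xs θ) i j / block w i j)
        + (G.lam i * b) * ∑ j, block g i j * (block w i j - block (xs θ) i j)
        + (G.lam i * b) ^ 2 * ∑ j, block g i j ^ 2 := by
    intro i
    refine mirror_step (hG.convex i) (hS.subset_simplex i) (mul_pos (hG.lam_pos i) hb) _
      (fun j => hw0 ⟨i, j⟩) (hw i) (hz i) (hG.mem hθ i)
      (fun j => hG.eq_zero_of_eq_zero hθ hz ⟨i, j⟩) fun y hy => ?_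
    have := hmax i hy
    simp only [Set.mem_ofPred_eq] at this
    rw [hval i y hy, hval i _ (hz i), EReal.coe_le_coe_iff] at this
    exact this
  have hsum := Finset.sum_le_sum fun i (_ : i ∈ Finset.univ) => hstep i
  rw [Finset.sum_add_distrib, Finset.sum_add_distrib, ← klReal_eq_sum_block,
    ← klReal_eq_sum_block] at hsum
  have hsq : ∑ i, (G.lam i * b) ^ 2 * ∑ j, block g i j ^ 2
      ≤ b ^ 2 * (∑ i, G.lam i) ^ 2 * ‖g‖ ^ 2 := by
    rw [EuclideanSpace.norm_sq_eq, Fintype.sum_sigma, Finset.mul_sum]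
    refine Finset.sum_le_sum fun i _ => ?_
    simp only [Real.norm_eq_abs, sq_abs, block]
    refine mul_le_mul_of_nonneg_right ?_ (Finset.sum_nonneg fun j _ => sq_nonneg _)
    rw [mul_pow, mul_comm]
    have := (hG.lam_pos i).le
    gcongr
    exact Finset.single_le_sum (fun i _ => (hG.lam_pos i).le) (Finset.mem_univ i)
  have hlin : ∑ i, (G.lam i * b) * ∑ j, block g i j * (block w i j - block (xs θ) i j)
      = b * ∑ p : Σ i, Fin (d i), G.lam p.1 * ((g - G.v θ w) p * (w p - xs θ p))
        - b * G.pairing θ w (xs θ) w := by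
    rw [pairing_eq_sum, ← mul_sub, ← Finset.sum_sub_distrib, Fintype.sum_sigma, Finset.mul_sum]
    refine Finset.sum_congr rfl fun i _ => ?_
    simp only [Finset.mul_sum]
    refine Finset.sum_congr rfl fun j _ => ?_
    simp only [block, PiLp.sub_apply]
    ring
  have hstab := mul_le_mul_of_nonneg_left (hG.klReal_le_pairing hS hθ hw) hb.le
  rw [hlin] at hsum
  linarith

/-- The payoff gradients are bounded, since they are at the equilibria and the divergence from
an equilibrium is bounded. -/
theorem SupportFloor.exists_norm_v_le (hF : G.SupportFloor xs S ε)
    (hG : G.GameAssumption xs Hu ρθ ρx) (hS : G.SimplexConstrained xs) {V : ℝ}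
    (hV : ∀ t ∈ G.Θ, ∀ i, ‖block (G.v t (xs t)) i‖ ≤ V) :
    ∃ B : ℝ, ∀ t ∈ G.Θ, ∀ x ∈ G.profiles, ‖G.v t x‖ ^ 2 ≤ B := by
  set D := Hu ^ 2 * (Fintype.card (Σ i, Fin (d i)) / ε)
  refine ⟨Fintype.card (Σ i, Fin (d i)) * (V + √D) ^ 2, fun t ht x hx => ?_⟩
  rw [EuclideanSpace.norm_sq_eq]
  refine (Finset.sum_le_card_nsmul _ _ ((V + √D) ^ 2) fun p _ => ?_).trans_eq (by simp)
  have h1 := (hG.norm_block_sub_sq_le hS ht hx p.1).trans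
    (mul_le_mul_of_nonneg_left (hF.klReal_le hS hG ht hx) (sq_nonneg Hu))
  have h2 := Real.le_sqrt_of_sq_le h1
  have h3 : ‖block (G.v t x) p.1‖ ≤ V + √D := by
    have e : block (G.v t x) p.1 = block (G.v t (xs t)) p.1
        - (block (G.v t (xs t)) p.1 - block (G.v t x) p.1) := by abel
    rw [e]
    exact (norm_sub_le _ _).trans (add_le_add (hV t ht _) h2)
  have h4 : ‖G.v t x p‖ ≤ V + √D := (norm_le_pi_norm (block (G.v t x) p.1) p.2).trans h3
  gcongr

variable {Jhat : Param m → Profile d → Matrix (Σ i, Fin (d i)) (Σ i, Fin (d i)) ℝ}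
  {gradF : Param m → Param m} {μ M Ht : ℝ}

theorem GameAssumption.norm_extGrad_sub_sq_le (hG : G.GameAssumption xs Hu ρθ ρx)
    (hS : G.SimplexConstrained xs) (hO : G.ObjectiveAssumption xs Jhat gradF μ M Ht)
    {θ : Param m} (hθ : θ ∈ G.Θ) {x : Profile d} (hx : x ∈ G.profiles) :
    ‖G.extGrad Jhat θ x - G.extGrad Jhat θ (xs θ)‖ ^ 2 ≤ Ht ^ 2 * klReal (xs θ) x := by
  have := hO.lipschitz θ hθ (xs θ) (hG.mem hθ) x hx
  rw [hG.klBar_eq hS hθ hx, ← ENNReal.ofReal_mul (by positivity)] at this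
  rw [norm_sub_rev]
  exact (ENNReal.ofReal_le_ofReal_iff
    (mul_nonneg (by positivity) (hG.klReal_nonneg hS hθ hx))).1 this

/-- One step of the designer from `θ` to `θ'`, with the gradient estimate `g` at the strategy
`y`. Only the component of `g` along `Θ` matters, so that `g` can be replaced by the sum of its
error, of the error made in `y`, and of the gradient of the reduced objective. -/
theorem SupportFloor.designer_step (hF : G.SupportFloor xs S ε)
    (hG : G.GameAssumption xs Hu ρθ ρx) (hS : G.SimplexConstrained xs)
    (hO : G.ObjectiveAssumption xs Jhat gradF μ M Ht) {θs : Param m} (hθs : θs ∈ G.Θ)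
    (hmin : IsMinOn (G.reduced xs) G.Θ θs) {a : ℝ} (ha : 0 < a) {θ θ' : Param m} (hθ : θ ∈ G.Θ)
    (hθ' : θ' ∈ G.Θ) {y : Profile d} (hy : y ∈ G.profiles) {g : Param m}
    (hmax : IsMaxOn (fun t : Param m => -⟪g, t⟫ - 1 / a * ‖t - θ‖ ^ 2) G.Θ θ') :
    ‖θ' - θ‖ ^ 2 ≤ a ^ 2 * (2 * ‖g - G.extGrad Jhat θ y‖ ^ 2
        + 2 * (Ht * √(Fintype.card (Σ i, Fin (d i)) / ε) + M) ^ 2) ∧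
    ‖θ' - θs‖ ^ 2 ≤ (1 - μ / 2 * a) * ‖θ - θs‖ ^ 2
      - a * ⟪θ - θs, g - G.extGrad Jhat θ y⟫ + a * (Ht ^ 2 / (2 * μ)) * klReal (xs θ) y
      + a ^ 2 * (2 * ‖g - G.extGrad Jhat θ y‖ ^ 2
        + 2 * (Ht * √(Fintype.card (Σ i, Fin (d i)) / ε) + M) ^ 2) := by
  set e := g - G.extGrad Jhat θ y with he
  set δ := G.extGrad Jhat θ y - G.extGrad Jhat θ (xs θ) with hδ
  set g' := e + δ + gradF θ with hg'
  set R := Ht * √(Fintype.card (Σ i, Fin (d i)) / ε) + M with hR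
  have hHt := hO.Ht_pos
  have hμ := hO.μ_pos
  have hδ2 : ‖δ‖ ^ 2 ≤ Ht ^ 2 * klReal (xs θ) y := hG.norm_extGrad_sub_sq_le hS hO hθ hy
  have hδR : ‖δ‖ ≤ Ht * √(Fintype.card (Σ i, Fin (d i)) / ε) := by
    have := Real.le_sqrt_of_sq_le (hδ2.trans
      (mul_le_mul_of_nonneg_left (hF.klReal_le hS hG hθ hy) (sq_nonneg Ht)))
    rwa [Real.sqrt_mul (sq_nonneg _), Real.sqrt_sq hHt.le] at this
  have hg'n : ‖g'‖ ≤ ‖e‖ + R := by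
    refine (norm_add₃_le).trans ?_
    rw [hR, add_assoc]
    gcongr
    exact hO.gradient_bound θ hθ
  have hg'2 : ‖g'‖ ^ 2 ≤ 2 * ‖e‖ ^ 2 + 2 * R ^ 2 := by
    nlinarith [norm_nonneg g', sq_nonneg (‖e‖ - R), norm_nonneg e]
  have hinner : ∀ u ∈ G.Θ, ⟪g, u - θ'⟫ = ⟪g', u - θ'⟫ := by
    intro u hu
    have e1 := hG.inner_extGrad_eq hS hO hθ hu
    have e2 := hG.inner_extGrad_eq hS hO hθ hθ'
    have e3 : u - θ' = (u - θ) - (θ' - θ) := by abel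
    have e4 : g = e + δ + G.extGrad Jhat θ (xs θ) := by rw [he, hδ]; abel
    rw [e4, hg', inner_add_left, inner_add_left (e + δ), e3, inner_sub_right (gradF θ),
      inner_sub_right (G.extGrad Jhat θ (xs θ)), e1, e2]
  have h1 := projected_three_point hO.convex ha hθ' hθ hmax
  have h2 := projected_three_point hO.convex ha hθ' hθs hmax
  rw [hinner _ hθ] at h1
  rw [hinner _ hθs] at h2
  have h3 : ⟪g', θ - θ'⟫ ≤ ‖g'‖ * ‖θ' - θ‖ := by
    rw [norm_sub_rev]; exact real_inner_le_norm _ _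
  have h3' := mul_le_mul_of_nonneg_left h3 ha.le
  have hyoung : a * (‖g'‖ * ‖θ' - θ‖) ≤ a ^ 2 * ‖g'‖ ^ 2 / 2 + ‖θ' - θ‖ ^ 2 / 2 := by
    nlinarith [sq_nonneg (a * ‖g'‖ - ‖θ' - θ‖)]
  have hag : a ^ 2 * ‖g'‖ ^ 2 ≤ a ^ 2 * (2 * ‖e‖ ^ 2 + 2 * R ^ 2) := by gcongr
  have hag0 : 0 ≤ a ^ 2 * ‖g'‖ ^ 2 := by positivity
  rw [sub_self, norm_zero] at h1
  refine ⟨by nlinarith, ?_⟩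
  have h4 : ⟪g', θs - θ'⟫ = ⟪g', θs - θ⟫ + ⟪g', θ - θ'⟫ := by
    rw [← inner_add_right]; congr 1; abel
  have h5 : ⟪g', θs - θ⟫ = -⟪θ - θs, e⟫ + ⟪δ, θs - θ⟫ + ⟪gradF θ, θs - θ⟫ := by
    rw [hg', inner_add_left, inner_add_left, ← neg_sub θ θs, inner_neg_right e,
      real_inner_comm e]
  have h6 : ⟪gradF θ, θs - θ⟫ ≤ -(μ * ‖θ - θs‖ ^ 2) := by
    have := hO.strongly_convex θs hθs θ hθ
    have hle : G.reduced xs θs ≤ G.reduced xs θ := hmin hθ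
    rw [norm_sub_rev θs] at this
    linarith
  have h7 : ⟪δ, θs - θ⟫ ≤ μ / 2 * ‖θ - θs‖ ^ 2 + Ht ^ 2 / (2 * μ) * klReal (xs θ) y := by
    have e1 := real_inner_le_norm δ (θs - θ)
    rw [norm_sub_rev θs] at e1
    have e2 : ‖δ‖ * ‖θ - θs‖ ≤ μ / 2 * ‖θ - θs‖ ^ 2 + ‖δ‖ ^ 2 / (2 * μ) := by
      rw [← sub_nonneg]
      have : μ / 2 * ‖θ - θs‖ ^ 2 + ‖δ‖ ^ 2 / (2 * μ) - ‖δ‖ * ‖θ - θs‖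
          = (μ * ‖θ - θs‖ - ‖δ‖) ^ 2 / (2 * μ) := by field_simp; ring
      rw [this]; positivity
    have e3 : ‖δ‖ ^ 2 / (2 * μ) ≤ Ht ^ 2 / (2 * μ) * klReal (xs θ) y := by
      rw [div_mul_eq_mul_div]; gcongr
    linarith
  have h8 : a * ⟪g', θs - θ⟫ ≤ a * (-⟪θ - θs, e⟫
      + (μ / 2 * ‖θ - θs‖ ^ 2 + Ht ^ 2 / (2 * μ) * klReal (xs θ) y)
      - μ * ‖θ - θs‖ ^ 2) := by
    gcongr
    rw [h5]; linarith
  rw [h4, mul_add] at h2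
  nlinarith

end Design

/-! ### Expected progress along a trajectory -/

/-- An error with vanishing conditional mean is orthogonal to bounded random vectors that are
determined by the history. -/
theorem integral_inner_eq_zero_of_condExp {Ω E : Type*} {m' m₀ : MeasurableSpace Ω}
    {P : Measure Ω} [IsProbabilityMeasure P] [NormedAddCommGroup E] [InnerProductSpace ℝ E]
    [CompleteSpace E] (hm : m' ≤ m₀) {Z f : Ω → E} (hZ : StronglyMeasurable[m'] Z) {c : ℝ}
    (hZc : ∀ ω, ‖Z ω‖ ≤ c) (hf : Integrable f P) (h0 : P[f | m'] =ᵐ[P] 0) :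
    Integrable (fun ω => ⟪Z ω, f ω⟫) P ∧ ∫ ω, ⟪Z ω, f ω⟫ ∂P = 0 := by
  refine ⟨(innerSL ℝ).integrable_of_bilin_of_bdd_left c (hZ.mono hm).aestronglyMeasurable
    (ae_of_all _ hZc) hf, ?_⟩
  have h := condExp_stronglyMeasurable_bilin_of_bound (innerSL ℝ) hm hZ hf c (ae_of_all _ hZc)
  have h1 := integral_condExp hm (μ := P) (f := fun ω => innerSL ℝ (Z ω) (f ω))
  rw [integral_congr_ae h] at h1
  simp only [innerSL_apply_apply] at h1
  rw [← h1]
  refine integral_eq_zero_of_ae ?_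
  filter_upwards [h0] with ω hω
  rw [hω]; simp

theorem measurable_klReal_comp {Ω : Type*} {mΩ : MeasurableSpace Ω} {X Y : Ω → Profile d}
    (hX : Measurable X) (hY : Measurable Y) : Measurable fun ω => klReal (X ω) (Y ω) := by
  unfold klReal
  refine Finset.measurable_sum _ fun p _ => ?_
  have h1 : Measurable fun ω => X ω p := (EuclideanSpace.proj (𝕜 := ℝ) p).measurable.comp hX
  have h2 : Measurable fun ω => Y ω p := (EuclideanSpace.proj (𝕜 := ℝ) p).measurable.comp hY
  exact h1.mul (Real.measurable_log.comp (h1.div h2))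

theorem continuous_mix (w : ℝ) : Continuous (mix w : Profile d → Profile d) := by
  unfold mix
  fun_prop

section History

variable {Ω : Type*} [MeasurableSpace Ω] {θ : ℕ → Ω → Param m} {x : ℕ → Ω → Profile d}

theorem histX_le (hθ : ∀ k, Measurable (θ k)) (hx : ∀ k, Measurable (x k)) (k : ℕ) :
    histX θ x k ≤ ‹MeasurableSpace Ω› :=
  sup_le (iSup₂_le fun l _ => (hθ l).comap_le) (iSup₂_le fun l _ => (hx l).comap_le)

theorem histTheta_le (hθ : ∀ k, Measurable (θ k)) (hx : ∀ k, Measurable (x k)) (k : ℕ) :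
    histTheta θ x k ≤ ‹MeasurableSpace Ω› :=
  sup_le (iSup₂_le fun l _ => (hθ l).comap_le) (iSup₂_le fun l _ => (hx l).comap_le)

omit [MeasurableSpace Ω] in
theorem measurable_histX_theta (k : ℕ) : Measurable[histX θ x k] (θ k) :=
  Measurable.of_comap_le (le_sup_of_le_left (le_iSup₂_of_le k Set.self_mem_Iic le_rfl))

omit [MeasurableSpace Ω] in
theorem measurable_histX_profile (k : ℕ) : Measurable[histX θ x k] (x k) :=
  Measurable.of_comap_le (le_sup_of_le_right (le_iSup₂_of_le k Set.self_mem_Iic le_rfl))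

omit [MeasurableSpace Ω] in
theorem measurable_histTheta_theta (k : ℕ) : Measurable[histTheta θ x k] (θ k) :=
  Measurable.of_comap_le (le_sup_of_le_left (le_iSup₂_of_le k Set.self_mem_Iic le_rfl))

omit [MeasurableSpace Ω] in
theorem measurable_mixedSeq {mΩ : MeasurableSpace Ω} {ν : ℕ → ℝ} {k : ℕ} (hx : Measurable (x k)) :
    Measurable (mixedSeq ν x k) := by
  cases k with
  | zero => exact hx
  | succ k => exact (continuous_mix (ν k)).measurable.comp hx

end History

theorem Design.GameAssumption.measurable_equilibrium_comp {Ω : Type*} {mΩ : MeasurableSpace Ω}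
    {G : Design m n d} {xs : Param m → Profile d} {Hu ρθ ρx : ℝ}
    (hG : G.GameAssumption xs Hu ρθ ρx) (hS : G.SimplexConstrained xs) (hΘ : Convex ℝ G.Θ)
    {t : Ω → Param m} (ht : Measurable t) (htΘ : ∀ ω, t ω ∈ G.Θ) :
    Measurable fun ω => xs (t ω) := by
  have hc : ContinuousOn xs G.Θ := fun θ hθ =>
    (hG.hasFDerivWithinAt_equilibrium hS hΘ hθ).continuousWithinAt
  exact hc.domRestrict.measurable.comp (ht.subtype_mk (h := htΘ))

/-- The standing assumptions along a trajectory: those of the two levels and on the estimates,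
with arbitrary step sizes and mixing weights. -/
structure Run {Ω : Type*} [MeasurableSpace Ω] (P : Measure Ω)
    (G : Design m n d) (xs : Param m → Profile d)
    (Jhat : Param m → Profile d → Matrix (Σ i, Fin (d i)) (Σ i, Fin (d i)) ℝ)
    (gradF : Param m → Param m) (Hu ρθ ρx μ M Ht δf δu : ℝ) (a b ν : ℕ → ℝ)
    (vhat : ℕ → Ω → Profile d) (ghat : ℕ → Ω → Param m)
    (θ : ℕ → Ω → Param m) (x : ℕ → Ω → Profile d) : Prop where
  simplex : G.SimplexConstrained xs
  game : G.GameAssumption xs Hu ρθ ρx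
  obj : G.ObjectiveAssumption xs Jhat gradF μ M Ht
  est : EstimateAssumption P G Jhat ν vhat ghat θ x δf δu
  traj : IsTrajectory G a b ν vhat ghat θ x
  a_pos : ∀ k, 0 < a k
  b_pos : ∀ k, 0 < b k
  ν_pos : ∀ k, 0 < ν k
  ν_le_one : ∀ k, ν k ≤ 1

namespace Run

variable {Ω : Type*} [MeasurableSpace Ω] {P : Measure Ω}
  {G : Design m n d} {xs : Param m → Profile d}
  {Jhat : Param m → Profile d → Matrix (Σ i, Fin (d i)) (Σ i, Fin (d i)) ℝ}
  {gradF : Param m → Param m} {Hu ρθ ρx μ M Ht δf δu : ℝ} {a b ν : ℕ → ℝ}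
  {vhat : ℕ → Ω → Profile d} {ghat : ℕ → Ω → Param m}
  {θ : ℕ → Ω → Param m} {x : ℕ → Ω → Profile d} {S : Set (Σ i, Fin (d i))} {ε : ℝ}
  (hR : Run P G xs Jhat gradF Hu ρθ ρx μ M Ht δf δu a b ν vhat ghat θ x)
include hR

theorem theta_mem (k : ℕ) (ω : Ω) : θ k ω ∈ G.Θ := by
  cases k with
  | zero => exact hR.traj.θ_init ω
  | succ k => exact hR.traj.θ_mem k ω

theorem x_mem (k : ℕ) (ω : Ω) : x k ω ∈ G.profiles := by
  cases k with
  | zero => exact hR.traj.x_init ω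
  | succ k => exact hR.traj.x_mem k ω

theorem mixed_mem (k : ℕ) (ω : Ω) : mixedSeq ν x k ω ∈ G.profiles := by
  cases k with
  | zero => exact hR.traj.x_init ω
  | succ k =>
    exact hR.simplex.mix_mem hR.game.convex (hR.x_mem (k + 1) ω) (hR.ν_pos k).le (hR.ν_le_one k)

theorem mixed_pos (k : ℕ) (ω : Ω) (p : Σ i, Fin (d i)) : 0 < mixedSeq ν x (k + 1) ω p := by
  have h1 := mul_nonneg (sub_nonneg.2 (hR.ν_le_one k)) (hR.simplex.nonneg (hR.x_mem (k + 1) ω) p)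
  have hd : 0 < (d p.1 : ℝ) := by exact_mod_cast p.2.pos
  have h2 : 0 < ν k * (1 / (d p.1 : ℝ)) := mul_pos (hR.ν_pos k) (by positivity)
  exact add_pos_of_nonneg_of_pos h1 h2

theorem measurable_xs (k : ℕ) : Measurable fun ω => xs (θ k ω) :=
  hR.game.measurable_equilibrium_comp hR.simplex hR.obj.convex (hR.est.θ_measurable k)
    (hR.theta_mem k)

theorem klReal_nonneg (k : ℕ) {y : Ω → Profile d} (hy : ∀ ω, y ω ∈ G.profiles) (ω : Ω) :
    0 ≤ klReal (xs (θ k ω)) (y ω) :=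
  hR.game.klReal_nonneg hR.simplex (hR.theta_mem k ω) (hy ω)

theorem integrable_klReal [IsProbabilityMeasure P] (hF : G.SupportFloor xs S ε) (k : ℕ)
    {y : Ω → Profile d} (hy : ∀ ω, y ω ∈ G.profiles) (hym : Measurable y) :
    Integrable (fun ω => klReal (xs (θ k ω)) (y ω)) P := by
  refine Integrable.of_bound (measurable_klReal_comp (hR.measurable_xs k) hym).aestronglyMeasurable
    (Fintype.card (Σ i, Fin (d i)) / ε) (ae_of_all _ fun ω => ?_)
  rw [Real.norm_eq_abs, abs_of_nonneg (hR.klReal_nonneg k hy ω)]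
  exact hF.klReal_le hR.simplex hR.game (hR.theta_mem k ω) (hy ω)

theorem measurable_mixed (k : ℕ) : Measurable (mixedSeq ν x k) :=
  measurable_mixedSeq (hR.est.x_measurable k)

/-- The agents' errors, in mean square. -/
theorem integral_sq_error_le [IsProbabilityMeasure P] (k : ℕ) :
    ∫ ω, ‖vhat k ω - G.v (θ k ω) (mixedSeq ν x k ω)‖ ^ 2 ∂P
      ≤ Fintype.card (Σ i, Fin (d i)) * δu ^ 2 := by
  have hm := histX_le hR.est.θ_measurable hR.est.x_measurable k
  set e := fun ω => vhat k ω - G.v (θ k ω) (mixedSeq ν x k ω) with he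
  have hL : MemLp e 2 P := hR.est.vhat_memLp k
  have hblock : ∀ i, Continuous fun y : Profile d => block y i := fun i => by
    unfold block; fun_prop
  have hint : ∀ i, Integrable (fun ω => ‖block (e ω) i‖ ^ 2) P := by
    intro i
    refine hL.integrable_norm_pow (p := 2) two_ne_zero |>.mono'
      (((hblock i).comp_aestronglyMeasurable hL.1).norm.pow 2) (ae_of_all _ fun ω => ?_)
    rw [Real.norm_eq_abs, abs_of_nonneg (by positivity)]
    gcongr
    exact (pi_norm_le_iff_of_nonneg (norm_nonneg _)).2 fun j => PiLp.norm_apply_le (e ω) ⟨i, j⟩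
  have hE : ∀ i, ∫ ω, ‖block (e ω) i‖ ^ 2 ∂P ≤ δu ^ 2 := by
    intro i
    rw [← integral_condExp hm]
    refine (integral_mono_ae integrable_condExp (integrable_const (δu ^ 2))
      (hR.est.vhat_error k i)).trans_eq (by simp)
  calc ∫ ω, ‖e ω‖ ^ 2 ∂P ≤ ∫ ω, ∑ p : Σ i, Fin (d i), ‖block (e ω) p.1‖ ^ 2 ∂P := by
        refine integral_mono (hL.integrable_norm_pow (p := 2) two_ne_zero)
          (integrable_finsetSum _ fun p _ => hint p.1) fun ω => ?_
        simp only
        rw [EuclideanSpace.norm_sq_eq]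
        refine Finset.sum_le_sum fun p _ => ?_
        gcongr
        exact norm_le_pi_norm (block (e ω) p.1) p.2
    _ = ∑ p : Σ i, Fin (d i), ∫ ω, ‖block (e ω) p.1‖ ^ 2 ∂P :=
        integral_finsetSum _ fun p _ => hint p.1
    _ ≤ _ := (Finset.sum_le_card_nsmul _ _ (δu ^ 2) fun p _ => hE p.1).trans_eq (by simp)

/-- The agents' errors have vanishing conditional mean. -/
theorem condExp_error_eq_zero [IsProbabilityMeasure P] {B : ℝ}
    (hB : ∀ t ∈ G.Θ, ∀ y ∈ G.profiles, ‖G.v t y‖ ^ 2 ≤ B) (k : ℕ) :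
    P[fun ω => vhat k ω - G.v (θ k ω) (mixedSeq ν x k ω) | histX θ x k] =ᵐ[P] 0 := by
  have hm := histX_le hR.est.θ_measurable hR.est.x_measurable k
  have hL := (hR.est.vhat_memLp k).integrable one_le_two
  have hv : Integrable (fun ω => G.v (θ k ω) (mixedSeq ν x k ω)) P := by
    refine Integrable.of_bound (C := √B) ?_
      (ae_of_all _ fun ω => Real.le_sqrt_of_sq_le (hB _ (hR.theta_mem k ω) _ (hR.mixed_mem k ω)))
    have := (hR.est.vhat_measurable k).aestronglyMeasurable.sub hL.1 (μ := P)
    simpa [Pi.sub_def] using this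
  have hvhat : Integrable (vhat k) P := by simpa [Pi.add_def] using hL.add hv
  have h1 := condExp_sub hvhat hv (histX θ x k)
  have h2 : P[fun ω => G.v (θ k ω) (mixedSeq ν x k ω) | histX θ x k]
      =ᵐ[P] P[vhat k | histX θ x k] := by
    refine (condExp_congr_ae (hR.est.vhat_unbiased k).symm).trans ?_
    rw [condExp_of_stronglyMeasurable hm stronglyMeasurable_condExp integrable_condExp]
  filter_upwards [h1, h2] with ω hω1 hω2
  refine Eq.trans hω1 ?_
  simp [hω2]

/-- Expected progress of the agents in one step, measured at a fixed equilibrium. -/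
theorem agents_expected [IsProbabilityMeasure P] (hF : G.SupportFloor xs S ε) {B : ℝ}
    (hB : ∀ t ∈ G.Θ, ∀ y ∈ G.profiles, ‖G.v t y‖ ^ 2 ≤ B) (k : ℕ) :
    ∫ ω, klReal (xs (θ (k + 1) ω)) (x (k + 2) ω) ∂P
      ≤ (1 - b (k + 1)) * ∫ ω, klReal (xs (θ (k + 1) ω)) (mixedSeq ν x (k + 1) ω) ∂P
        + b (k + 1) ^ 2 * ((∑ i, G.lam i) ^ 2
          * (2 * (Fintype.card (Σ i, Fin (d i)) * δu ^ 2) + 2 * B)) := by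
  set e := fun ω => vhat (k + 1) ω - G.v (θ (k + 1) ω) (mixedSeq ν x (k + 1) ω) with he
  set T := Matrix.toEuclideanCLM (𝕜 := ℝ)
    (Matrix.diagonal fun p : Σ i, Fin (d i) => G.lam p.1) with hT
  set Z := fun ω => T (mixedSeq ν x (k + 1) ω - xs (θ (k + 1) ω)) with hZ
  have hm := histX_le hR.est.θ_measurable hR.est.x_measurable (k + 1)
  have hL : MemLp e 2 P := hR.est.vhat_memLp (k + 1)
  have hZm : Measurable[histX θ x (k + 1)] Z := T.measurable.comp
    ((measurable_mixedSeq (measurable_histX_profile (k + 1))).sub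
      (hR.game.measurable_equilibrium_comp hR.simplex hR.obj.convex
        (measurable_histX_theta (k + 1)) (hR.theta_mem (k + 1))))
  obtain ⟨hint, hzero⟩ := integral_inner_eq_zero_of_condExp hm hZm.stronglyMeasurable
    (c := ‖T‖ * √(Fintype.card (Σ i, Fin (d i)))) (fun ω => (T.le_opNorm _).trans
      (mul_le_mul_of_nonneg_left (Real.le_sqrt_of_sq_le (hR.simplex.norm_sub_le
        (hR.mixed_mem (k + 1) ω) (hR.game.mem (hR.theta_mem (k + 1) ω)))) (norm_nonneg _)))
    (hL.integrable one_le_two) (hR.condExp_error_eq_zero hB (k + 1))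
  have hsq := hL.integrable_norm_pow (p := 2) two_ne_zero
  have hD := hR.integrable_klReal hF (k + 1) (hR.x_mem (k + 2)) (hR.est.x_measurable (k + 2))
  have hDm := hR.integrable_klReal hF (k + 1) (hR.mixed_mem (k + 1)) (hR.measurable_mixed (k + 1))
  have hbp := hR.b_pos (k + 1)
  have hpoint : ∀ ω, klReal (xs (θ (k + 1) ω)) (x (k + 2) ω)
      ≤ (1 - b (k + 1)) * klReal (xs (θ (k + 1) ω)) (mixedSeq ν x (k + 1) ω)
        + b (k + 1) * ⟪Z ω, e ω⟫
        + b (k + 1) ^ 2 * ((∑ i, G.lam i) ^ 2 * (2 * ‖e ω‖ ^ 2 + 2 * B)) := by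
    intro ω
    have h1 := hR.game.klReal_le_of_step hR.simplex (hR.theta_mem (k + 1) ω) hbp
      (vhat (k + 1) ω) (hR.mixed_mem (k + 1) ω) (hR.mixed_pos k ω) (hR.x_mem (k + 2) ω)
      (hR.traj.x_step (k + 1) ω)
    have h2 : ⟪Z ω, e ω⟫ = ∑ p : Σ i, Fin (d i), G.lam p.1 * (e ω p *
        (mixedSeq ν x (k + 1) ω p - xs (θ (k + 1) ω) p)) := by
      rw [real_inner_comm, hZ, hT, Matrix.inner_toEuclideanCLM]
      simp only [dotProduct, Matrix.mulVec_diagonal, PiLp.sub_apply]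
      exact Finset.sum_congr rfl fun p _ => by ring
    have h3 : ‖vhat (k + 1) ω‖ ^ 2 ≤ 2 * ‖e ω‖ ^ 2 + 2 * B := by
      have h4 := hB _ (hR.theta_mem (k + 1) ω) _ (hR.mixed_mem (k + 1) ω)
      have h5 : ‖vhat (k + 1) ω‖ ≤ ‖e ω‖ + ‖G.v (θ (k + 1) ω) (mixedSeq ν x (k + 1) ω)‖ := by
        have : vhat (k + 1) ω = e ω + G.v (θ (k + 1) ω) (mixedSeq ν x (k + 1) ω) := by
          rw [he]; simp
        rw [this]; exact norm_add_le _ _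
      nlinarith [norm_nonneg (vhat (k + 1) ω), sq_nonneg
        (‖e ω‖ - ‖G.v (θ (k + 1) ω) (mixedSeq ν x (k + 1) ω)‖), norm_nonneg (e ω)]
    rw [h2]
    refine h1.trans (add_le_add le_rfl ?_)
    rw [mul_assoc]
    gcongr
  have hi1 : Integrable (fun ω => (1 - b (k + 1)) * klReal (xs (θ (k + 1) ω))
      (mixedSeq ν x (k + 1) ω) + b (k + 1) * ⟪Z ω, e ω⟫) P :=
    (hDm.const_mul (1 - b (k + 1))).add (hint.const_mul (b (k + 1)))
  have hi2 : Integrable (fun ω => b (k + 1) ^ 2 * ((∑ i, G.lam i) ^ 2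
      * (2 * ‖e ω‖ ^ 2 + 2 * B))) P :=
    (((hsq.const_mul 2).add (integrable_const _)).const_mul _).const_mul _
  refine (integral_mono hD (hi1.add hi2) hpoint).trans ?_
  simp only [Pi.add_apply]
  rw [integral_add hi1 hi2, integral_add (hDm.const_mul _) (hint.const_mul _),
    integral_const_mul, integral_const_mul, hzero, mul_zero, add_zero, integral_const_mul,
    integral_const_mul, integral_add (hsq.const_mul 2) (integrable_const _), integral_const_mul]
  have := hR.integral_sq_error_le (k + 1)
  simp only [integral_const, probReal_univ, one_smul]
  gcongr

/-- The designer's errors, in mean square. -/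
theorem integral_sq_designer_error_le [IsProbabilityMeasure P] (k : ℕ) :
    ∫ ω, ‖ghat k ω - G.extGrad Jhat (θ k ω) (mixedSeq ν x (k + 1) ω)‖ ^ 2 ∂P ≤ δf ^ 2 := by
  rw [← integral_condExp (histTheta_le hR.est.θ_measurable hR.est.x_measurable k)]
  exact (integral_mono_ae integrable_condExp (integrable_const (δf ^ 2))
    (hR.est.ghat_error k)).trans_eq (by simp)

theorem integral_klReal_mixed_le [IsProbabilityMeasure P] (hF : G.SupportFloor xs S ε) (k : ℕ) :
    ∫ ω, klReal (xs (θ k ω)) (mixedSeq ν x (k + 1) ω) ∂P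
      ≤ ∫ ω, klReal (xs (θ k ω)) (x (k + 1) ω) ∂P
        + ν k * ∑ p : Σ i, Fin (d i), Real.log (d p.1) := by
  have hD := hR.integrable_klReal hF k (hR.x_mem (k + 1)) (hR.est.x_measurable (k + 1))
  have hDm := hR.integrable_klReal hF k (hR.mixed_mem (k + 1)) (hR.measurable_mixed (k + 1))
  refine (integral_mono hDm (hD.add (integrable_const _)) fun ω =>
    hF.klReal_mix_le hR.simplex hR.game (hR.theta_mem k ω) (hR.x_mem (k + 1) ω)
      (hR.ν_pos k).le (hR.ν_le_one k)).trans_eq ?_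
  simp only [Pi.add_apply]
  rw [integral_add hD (integrable_const _)]
  simp

/-- Expected increase of the divergence when the equilibrium moves. -/
theorem move_expected [IsProbabilityMeasure P] (hF : G.SupportFloor xs S ε) (k : ℕ) {η : ℝ}
    (hη : 0 < η) :
    ∫ ω, klReal (xs (θ (k + 1) ω)) (mixedSeq ν x (k + 1) ω) ∂P
      ≤ (1 + η) * ∫ ω, klReal (xs (θ k ω)) (mixedSeq ν x (k + 1) ω) ∂P
        + (1 / (η * ε ^ 2) + 1 / ε) * (4 * (∑ i, G.lam i) * ρθ) ^ 2 * (a k ^ 2 * (2 * δf ^ 2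
          + 2 * (Ht * √(Fintype.card (Σ i, Fin (d i)) / ε) + M) ^ 2)) := by
  set e := fun ω => ghat k ω - G.extGrad Jhat (θ k ω) (mixedSeq ν x (k + 1) ω) with he
  set R := Ht * √(Fintype.card (Σ i, Fin (d i)) / ε) + M
  have hε := hF.pos
  have hL : MemLp e 2 P := hR.est.ghat_memLp k
  have hsq := hL.integrable_norm_pow (p := 2) two_ne_zero
  have hD := hR.integrable_klReal hF (k + 1) (hR.mixed_mem (k + 1)) (hR.measurable_mixed (k + 1))
  have hDm := hR.integrable_klReal hF k (hR.mixed_mem (k + 1)) (hR.measurable_mixed (k + 1))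
  have hpoint : ∀ ω, klReal (xs (θ (k + 1) ω)) (mixedSeq ν x (k + 1) ω)
      ≤ (1 + η) * klReal (xs (θ k ω)) (mixedSeq ν x (k + 1) ω)
        + (1 / (η * ε ^ 2) + 1 / ε) * (4 * (∑ i, G.lam i) * ρθ) ^ 2
          * (a k ^ 2 * (2 * ‖e ω‖ ^ 2 + 2 * R ^ 2)) := by
    intro ω
    have hθk := hR.theta_mem k ω
    have hθk' := hR.theta_mem (k + 1) ω
    -- any minimizer will do, as the bound on the length of the step does not depend on it
    obtain ⟨θs, hθs, hmin⟩ := hR.obj.compact.exists_isMinOn ⟨_, hθk⟩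
      (fun t ht => (hR.obj.hasGradient t ht).continuousWithinAt)
    have h1 := (hF.designer_step hR.game hR.simplex hR.obj hθs hmin (hR.a_pos k) hθk hθk'
      (hR.mixed_mem (k + 1) ω) (hR.traj.θ_step k ω)).1
    have h2 := hR.game.norm_sub_le_of_equilibrium hR.simplex hR.obj.convex hθk hθk'
    refine (hF.klReal_le_of_move hR.simplex hR.game hθk hθk' (hR.mixed_mem (k + 1) ω) hη).trans ?_
    rw [mul_assoc (_ + _)]
    gcongr
    calc ‖xs (θ (k + 1) ω) - xs (θ k ω)‖ ^ 2
        ≤ (4 * (∑ i, G.lam i) * ρθ * ‖θ (k + 1) ω - θ k ω‖) ^ 2 := by gcongr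
      _ = (4 * (∑ i, G.lam i) * ρθ) ^ 2 * ‖θ (k + 1) ω - θ k ω‖ ^ 2 := mul_pow _ _ _
      _ ≤ _ := by gcongr
  have hi : Integrable (fun ω => (1 / (η * ε ^ 2) + 1 / ε) * (4 * (∑ i, G.lam i) * ρθ) ^ 2
      * (a k ^ 2 * (2 * ‖e ω‖ ^ 2 + 2 * R ^ 2))) P :=
    (((hsq.const_mul 2).add (integrable_const _)).const_mul _).const_mul _
  refine (integral_mono hD ((hDm.const_mul _).add hi) hpoint).trans ?_
  simp only [Pi.add_apply]
  rw [integral_add (hDm.const_mul _) hi, integral_const_mul, integral_const_mul,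
    integral_const_mul, integral_add (hsq.const_mul 2) (integrable_const _), integral_const_mul]
  have := hR.integral_sq_designer_error_le k
  simp only [integral_const, probReal_univ, one_smul]
  gcongr

theorem integrable_sq_dist [IsProbabilityMeasure P] {θs : Param m} (hθs : θs ∈ G.Θ) (k : ℕ) :
    Integrable (fun ω => ‖θ k ω - θs‖ ^ 2) P := by
  obtain ⟨C, hC⟩ := Metric.isBounded_iff.1 hR.obj.compact.isBounded
  refine Integrable.of_bound
    ((((hR.est.θ_measurable k).sub_const θs).norm.pow_const 2).aestronglyMeasurable) (C ^ 2)
    (ae_of_all _ fun ω => ?_)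
  have := hC (hR.theta_mem k ω) hθs
  rw [dist_eq_norm] at this
  rw [Real.norm_eq_abs, abs_of_nonneg (by positivity)]
  gcongr

/-- Expected progress of the designer in one step. -/
theorem designer_expected [IsProbabilityMeasure P] (hF : G.SupportFloor xs S ε) {θs : Param m}
    (hθs : θs ∈ G.Θ) (hmin : IsMinOn (G.reduced xs) G.Θ θs) (k : ℕ) :
    ∫ ω, ‖θ (k + 1) ω - θs‖ ^ 2 ∂P ≤ (1 - μ / 2 * a k) * ∫ ω, ‖θ k ω - θs‖ ^ 2 ∂P
      + a k * (Ht ^ 2 / (2 * μ)) * ∫ ω, klReal (xs (θ k ω)) (mixedSeq ν x (k + 1) ω) ∂P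
      + a k ^ 2 * (2 * δf ^ 2
        + 2 * (Ht * √(Fintype.card (Σ i, Fin (d i)) / ε) + M) ^ 2) := by
  set e := fun ω => ghat k ω - G.extGrad Jhat (θ k ω) (mixedSeq ν x (k + 1) ω) with he
  set R := Ht * √(Fintype.card (Σ i, Fin (d i)) / ε) + M
  have hm := histTheta_le hR.est.θ_measurable hR.est.x_measurable k
  have hL : MemLp e 2 P := hR.est.ghat_memLp k
  have hsq := hL.integrable_norm_pow (p := 2) two_ne_zero
  have hDm := hR.integrable_klReal hF k (hR.mixed_mem (k + 1)) (hR.measurable_mixed (k + 1))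
  obtain ⟨C, hC⟩ := Metric.isBounded_iff.1 hR.obj.compact.isBounded
  have hZm : Measurable[histTheta θ x k] fun ω => θ k ω - θs :=
    (measurable_histTheta_theta k).sub_const θs
  obtain ⟨hint, hzero⟩ := integral_inner_eq_zero_of_condExp hm hZm.stronglyMeasurable
    (c := C) (fun ω => by rw [← dist_eq_norm]; exact hC (hR.theta_mem k ω) hθs)
    (hL.integrable one_le_two) (hR.est.ghat_unbiased k)
  have hpoint : ∀ ω, ‖θ (k + 1) ω - θs‖ ^ 2 ≤ (1 - μ / 2 * a k) * ‖θ k ω - θs‖ ^ 2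
      - a k * ⟪θ k ω - θs, e ω⟫
      + a k * (Ht ^ 2 / (2 * μ)) * klReal (xs (θ k ω)) (mixedSeq ν x (k + 1) ω)
      + a k ^ 2 * (2 * ‖e ω‖ ^ 2 + 2 * R ^ 2) := fun ω =>
    (hF.designer_step hR.game hR.simplex hR.obj hθs hmin (hR.a_pos k) (hR.theta_mem k ω)
      (hR.theta_mem (k + 1) ω) (hR.mixed_mem (k + 1) ω) (hR.traj.θ_step k ω)).2
  have hi0 := (hR.integrable_sq_dist hθs k).const_mul (1 - μ / 2 * a k)
  have hi1 : Integrable (fun ω => (1 - μ / 2 * a k) * ‖θ k ω - θs‖ ^ 2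
      - a k * ⟪θ k ω - θs, e ω⟫) P := hi0.sub (hint.const_mul (a k))
  have hi2 : Integrable (fun ω => (1 - μ / 2 * a k) * ‖θ k ω - θs‖ ^ 2
      - a k * ⟪θ k ω - θs, e ω⟫
      + a k * (Ht ^ 2 / (2 * μ)) * klReal (xs (θ k ω)) (mixedSeq ν x (k + 1) ω)) P :=
    hi1.add (hDm.const_mul (a k * (Ht ^ 2 / (2 * μ))))
  have hi3 : Integrable (fun ω => a k ^ 2 * (2 * ‖e ω‖ ^ 2 + 2 * R ^ 2)) P :=
    ((hsq.const_mul 2).add (integrable_const _)).const_mul _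
  refine (integral_mono (hR.integrable_sq_dist hθs (k + 1)) (hi2.add hi3) hpoint).trans ?_
  simp only [Pi.add_apply]
  rw [integral_add hi2 hi3, integral_add hi1 (hDm.const_mul _), integral_sub hi0
    (hint.const_mul _), integral_const_mul, integral_const_mul, integral_const_mul,
    integral_const_mul, hzero, mul_zero, sub_zero,
    integral_add (hsq.const_mul 2) (integrable_const _), integral_const_mul]
  have := hR.integral_sq_designer_error_le k
  simp only [integral_const, probReal_univ, one_smul]
  gcongr

end Run

/-! ### Rates -/

/-- A contraction by `1 - b` absorbs an expansion by `1 + b / 2`. -/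
theorem contract_after_move {b u q X W w : ℝ} (hb : 0 ≤ b) (hb1 : b ≤ 1) (hu : 0 ≤ u)
    (hq : 0 ≤ q) (hX : 0 ≤ X) (hw : w ≤ u + q) (hW : W ≤ (1 + b / 2) * w + X) :
    (1 - b) * W ≤ (1 - b / 2) * u + q + X := by
  have h1 : W ≤ (1 + b / 2) * (u + q) + X := hW.trans (by gcongr)
  have h2 := mul_le_mul_of_nonneg_left h1 (sub_nonneg.2 hb1)
  have h3 := mul_nonneg hb hX
  have h4 := mul_nonneg hb hq
  have h5 := mul_nonneg (mul_nonneg hb hb) (add_nonneg hu hq)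
  linarith

namespace Run

variable {Ω : Type*} [MeasurableSpace Ω] {P : Measure Ω}
  {G : Design m n d} {xs : Param m → Profile d}
  {Jhat : Param m → Profile d → Matrix (Σ i, Fin (d i)) (Σ i, Fin (d i)) ℝ}
  {gradF : Param m → Param m} {Hu ρθ ρx μ M Ht δf δu : ℝ} {a b ν : ℕ → ℝ}
  {vhat : ℕ → Ω → Profile d} {ghat : ℕ → Ω → Param m}
  {θ : ℕ → Ω → Param m} {x : ℕ → Ω → Profile d} {S : Set (Σ i, Fin (d i))} {ε : ℝ}
  (hR : Run P G xs Jhat gradF Hu ρθ ρx μ M Ht δf δu a b ν vhat ghat θ x)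
include hR

/-- The rate of the agents: the contraction by `1 - b k` competes with the terms `b k ^ 2` (noise),
`ν k` (mixing) and `a k ^ 2 / b k` (motion of the equilibrium), which are all `O(k ^ (-4 / 7))`. -/
theorem exists_agents_rate [IsProbabilityMeasure P] (hF : G.SupportFloor xs S ε) {V α β : ℝ}
    (hV : ∀ t ∈ G.Θ, ∀ i, ‖block (G.v t (xs t)) i‖ ≤ V) (hβ : 0 < β)
    (ha : ∀ k : ℕ, a k = α / ((k : ℝ) + 1) ^ (1 / 2 : ℝ))
    (hb : ∀ k : ℕ, b k = β / ((k : ℝ) + 1) ^ (2 / 7 : ℝ))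
    (hν : ∀ k : ℕ, ν k = 1 / ((k : ℝ) + 1) ^ (4 / 7 : ℝ)) :
    ∃ B : ℝ, 0 ≤ B ∧ ∀ k : ℕ, ∫ ω, klReal (xs (θ k ω)) (x (k + 1) ω) ∂P
      ≤ B * ((k : ℝ) + 1) ^ (-(2 / 7) : ℝ) := by
  obtain ⟨B, hB⟩ := hF.exists_norm_v_le hR.game hR.simplex hV
  set C₁ := (∑ i, G.lam i) ^ 2 * (2 * (Fintype.card (Σ i, Fin (d i)) * δu ^ 2) + 2 * B) with hC₁
  set c := ∑ p : Σ i, Fin (d i), Real.log (d p.1) with hc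
  set E := 2 * δf ^ 2 + 2 * (Ht * √(Fintype.card (Σ i, Fin (d i)) / ε) + M) ^ 2 with hE
  set L := (4 * (∑ i, G.lam i) * ρθ) ^ 2 with hL
  have hε := hF.pos
  have hc0 : 0 ≤ c := Finset.sum_nonneg fun p _ =>
    Real.log_nonneg (by exact_mod_cast p.2.pos)
  have hB0 : 0 ≤ B := by
    obtain ⟨ω⟩ : Nonempty Ω := P.nonempty_of_neZero
    exact (sq_nonneg _).trans (hB _ (hR.theta_mem 0 ω) _ (hR.x_mem 0 ω))
  have hC₁0 : 0 ≤ C₁ := by positivity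
  have hE0 : 0 ≤ E := by positivity
  have hL0 : 0 ≤ L := by positivity
  have htend : Tendsto (fun k : ℕ => ((k : ℝ) + 1) + 1) atTop atTop :=
    tendsto_atTop_add_const_right _ _
      (tendsto_atTop_add_const_right _ _ tendsto_natCast_atTop_atTop)
  have hev : ∀ᶠ k : ℕ in atTop, β * (((k : ℝ) + 1) + 1) ^ (-(2 / 7) : ℝ) < 1 := by
    have := ((tendsto_rpow_neg_atTop (show (0 : ℝ) < 2 / 7 by norm_num)).comp htend).const_mul β
    rw [mul_zero] at this
    exact this.eventually_lt_const one_pos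
  obtain ⟨K, hK⟩ := hev.exists_forall_of_atTop
  refine exists_le_rpow_of_recursion (K := K) (c := β / 4) (s := 2 / 7)
    (C := c + 2 / β * (2 / ε ^ 2 + 1 / ε) * L * (α ^ 2 * E) + β ^ 2 * C₁)
    (by positivity) (by norm_num) (by norm_num) (by norm_num) fun k hk => ?_
  set t : ℝ := (k : ℝ) + 1 with ht
  have ht1 : 1 ≤ t := by rw [ht]; linarith [k.cast_nonneg (α := ℝ)]
  have ht0 : 0 < t := by linarith
  set u := ∫ ω, klReal (xs (θ k ω)) (x (k + 1) ω) ∂P with hu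
  have hu0 : 0 ≤ u := integral_nonneg fun ω => hR.klReal_nonneg k (hR.x_mem (k + 1)) ω
  have hbp := hR.b_pos (k + 1)
  -- the step size `b (k + 1)` is a power of `t + 1`, which lies between `t` and `2 * t`
  have hbk : b (k + 1) = β * (t + 1) ^ (-(2 / 7) : ℝ) := by
    rw [hb, Real.rpow_neg (by positivity), ← div_eq_mul_inv]; push_cast; rfl
  have hb1 : b (k + 1) ≤ 1 := by rw [hbk]; exact (hK k hk).le
  have hbup : b (k + 1) ≤ β * t ^ (-(2 / 7) : ℝ) := by
    rw [hbk]
    exact mul_le_mul_of_nonneg_left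
      (Real.rpow_le_rpow_of_nonpos ht0 (by linarith) (by norm_num)) hβ.le
  have hblow : β / 2 * t ^ (-(2 / 7) : ℝ) ≤ b (k + 1) := by
    have h2 : (1 / 2 : ℝ) ≤ 2 ^ (-(2 / 7) : ℝ) := by
      rw [one_div, ← Real.rpow_neg_one]
      exact Real.rpow_le_rpow_of_exponent_le (by norm_num) (by norm_num)
    have h3 : 2 ^ (-(2 / 7) : ℝ) * t ^ (-(2 / 7) : ℝ) ≤ (t + 1) ^ (-(2 / 7) : ℝ) := by
      rw [← Real.mul_rpow (by norm_num) ht0.le]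
      exact Real.rpow_le_rpow_of_nonpos (by linarith) (by linarith) (by norm_num)
    rw [hbk, div_mul_eq_mul_div, mul_div_assoc]
    gcongr
    refine le_trans ?_ h3
    rw [div_eq_inv_mul, ← one_div]
    gcongr
  have hνk : ν k = t ^ (-(2 / 7 + 2 / 7) : ℝ) := by
    rw [hν, ← ht, Real.rpow_neg ht0.le, one_div]; norm_num
  have hbsq : b (k + 1) ^ 2 ≤ β ^ 2 * t ^ (-(2 / 7 + 2 / 7) : ℝ) := by
    calc b (k + 1) ^ 2 ≤ (β * t ^ (-(2 / 7) : ℝ)) ^ 2 := by gcongr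
      _ = β ^ 2 * t ^ (-(2 / 7 + 2 / 7) : ℝ) := by
        rw [mul_pow, neg_add, Real.rpow_add ht0, sq (t ^ _)]
  have hasq : a k ^ 2 = α ^ 2 * t ^ (-1 : ℝ) := by
    rw [ha, ← ht, div_pow, ← Real.sqrt_eq_rpow, Real.sq_sqrt ht0.le, Real.rpow_neg_one,
      div_eq_mul_inv]
  have hmove : 1 / b (k + 1) * a k ^ 2 ≤ 2 / β * α ^ 2 * t ^ (-(2 / 7 + 2 / 7) : ℝ) := by
    have e1 : 1 / b (k + 1) ≤ 2 / β * t ^ (2 / 7 : ℝ) := by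
      rw [div_le_iff₀ hbp]
      calc (1 : ℝ) = 2 / β * t ^ (2 / 7 : ℝ) * (β / 2 * t ^ (-(2 / 7) : ℝ)) := by
            rw [Real.rpow_neg ht0.le]; field_simp
        _ ≤ _ := by gcongr
    have e2 : t ^ (2 / 7 : ℝ) * t ^ (-1 : ℝ) ≤ t ^ (-(2 / 7 + 2 / 7) : ℝ) := by
      rw [← Real.rpow_add ht0]
      exact Real.rpow_le_rpow_of_exponent_le ht1 (by norm_num)
    calc 1 / b (k + 1) * a k ^ 2 ≤ 2 / β * t ^ (2 / 7 : ℝ) * (α ^ 2 * t ^ (-1 : ℝ)) := by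
          rw [hasq]; gcongr
      _ = 2 / β * α ^ 2 * (t ^ (2 / 7 : ℝ) * t ^ (-1 : ℝ)) := by ring
      _ ≤ _ := by gcongr
  have h1 := hR.agents_expected hF hB k
  have h2 := hR.move_expected hF k (half_pos hbp)
  have h3 := hR.integral_klReal_mixed_le hF k
  rw [← hu, ← hc] at h3
  rw [← hC₁] at h1
  rw [← hE, ← hL] at h2
  set W := ∫ ω, klReal (xs (θ (k + 1) ω)) (mixedSeq ν x (k + 1) ω) ∂P
  set w := ∫ ω, klReal (xs (θ k ω)) (mixedSeq ν x (k + 1) ω) ∂P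
  have hνc : 0 ≤ ν k * c := mul_nonneg (hR.ν_pos k).le hc0
  have hX : (1 / (b (k + 1) / 2 * ε ^ 2) + 1 / ε) * L * (a k ^ 2 * E)
      ≤ 2 / β * (2 / ε ^ 2 + 1 / ε) * L * (α ^ 2 * E) * t ^ (-(2 / 7 + 2 / 7) : ℝ) := by
    have e1 : 1 / (b (k + 1) / 2 * ε ^ 2) + 1 / ε ≤ 1 / b (k + 1) * (2 / ε ^ 2 + 1 / ε) := by
      have e2 : 1 / ε ≤ 1 / b (k + 1) * (1 / ε) :=
        le_mul_of_one_le_left (by positivity) ((one_le_div hbp).2 hb1)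
      have e3 : 1 / (b (k + 1) / 2 * ε ^ 2) = 1 / b (k + 1) * (2 / ε ^ 2) := by field_simp
      rw [e3, mul_add]
      gcongr
    calc (1 / (b (k + 1) / 2 * ε ^ 2) + 1 / ε) * L * (a k ^ 2 * E)
        ≤ 1 / b (k + 1) * (2 / ε ^ 2 + 1 / ε) * L * (a k ^ 2 * E) := by gcongr
      _ = (1 / b (k + 1) * a k ^ 2) * ((2 / ε ^ 2 + 1 / ε) * L * E) := by ring
      _ ≤ (2 / β * α ^ 2 * t ^ (-(2 / 7 + 2 / 7) : ℝ)) * ((2 / ε ^ 2 + 1 / ε) * L * E) := by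
          gcongr
      _ = _ := by ring
  have hX0 : 0 ≤ (1 / (b (k + 1) / 2 * ε ^ 2) + 1 / ε) * L * (a k ^ 2 * E) := by positivity
  have h4 := contract_after_move hbp.le hb1 hu0 hνc hX0 h3 h2
  have h5 : (1 - b (k + 1) / 2) * u ≤ (1 - β / 4 * t ^ (-(2 / 7) : ℝ)) * u := by
    gcongr ?_ * u
    linarith
  have h6 : b (k + 1) ^ 2 * C₁ ≤ β ^ 2 * t ^ (-(2 / 7 + 2 / 7) : ℝ) * C₁ := by gcongr
  rw [hνk] at h4
  refine h1.trans ?_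
  linarith

/-- The rate of the designer, driven by the rate of the agents. -/
theorem exists_designer_rate [IsProbabilityMeasure P] (hF : G.SupportFloor xs S ε) {B α : ℝ}
    {θs : Param m} (hθs : θs ∈ G.Θ) (hmin : IsMinOn (G.reduced xs) G.Θ θs) (hα : 0 < α)
    (ha : ∀ k : ℕ, a k = α / ((k : ℝ) + 1) ^ (1 / 2 : ℝ))
    (hν : ∀ k : ℕ, ν k = 1 / ((k : ℝ) + 1) ^ (4 / 7 : ℝ))
    (hB : ∀ k : ℕ, ∫ ω, klReal (xs (θ k ω)) (x (k + 1) ω) ∂P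
      ≤ B * ((k : ℝ) + 1) ^ (-(2 / 7) : ℝ)) :
    ∃ C : ℝ, 0 ≤ C ∧ ∀ k : ℕ, ∫ ω, ‖θ k ω - θs‖ ^ 2 ∂P
      ≤ C * ((k : ℝ) + 1) ^ (-(2 / 7) : ℝ) := by
  set c := ∑ p : Σ i, Fin (d i), Real.log (d p.1) with hc
  set E := 2 * δf ^ 2 + 2 * (Ht * √(Fintype.card (Σ i, Fin (d i)) / ε) + M) ^ 2 with hE
  have hμ := hR.obj.μ_pos
  have hc0 : 0 ≤ c := Finset.sum_nonneg fun p _ =>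
    Real.log_nonneg (by exact_mod_cast p.2.pos)
  have hE0 : 0 ≤ E := by positivity
  refine exists_le_rpow_of_recursion (K := 0) (c := μ / 2 * α) (s := 1 / 2)
    (C := α * (Ht ^ 2 / (2 * μ)) * (B + c) + α ^ 2 * E)
    (by positivity) (by norm_num) (by norm_num) (by norm_num) fun k _ => ?_
  set t : ℝ := (k : ℝ) + 1 with ht
  have ht1 : 1 ≤ t := by rw [ht]; linarith [k.cast_nonneg (α := ℝ)]
  have ht0 : 0 < t := by linarith
  have hak : a k = α * t ^ (-(1 / 2) : ℝ) := by
    rw [ha, Real.rpow_neg ht0.le, ← div_eq_mul_inv]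
  have hasq : a k ^ 2 ≤ α ^ 2 * t ^ (-(1 / 2 + 2 / 7) : ℝ) := by
    rw [hak, mul_pow, sq (t ^ _), ← Real.rpow_add ht0]
    refine mul_le_mul_of_nonneg_left ?_ (sq_nonneg α)
    exact Real.rpow_le_rpow_of_exponent_le ht1 (by norm_num)
  have hνk : ν k ≤ t ^ (-(2 / 7) : ℝ) := by
    rw [hν, one_div, ← Real.rpow_neg ht0.le]
    exact Real.rpow_le_rpow_of_exponent_le ht1 (by norm_num)
  have h1 := hR.designer_expected hF hθs hmin k
  have h2 := hR.integral_klReal_mixed_le hF k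
  have h3 := hB k
  rw [← hc] at h2
  rw [← hE] at h1
  set w := ∫ ω, klReal (xs (θ k ω)) (mixedSeq ν x (k + 1) ω) ∂P
  have h4 : w ≤ (B + c) * t ^ (-(2 / 7) : ℝ) := by
    have := mul_le_mul_of_nonneg_right hνk hc0
    rw [← ht] at h3
    linarith
  have h5 : a k * (Ht ^ 2 / (2 * μ)) * w
      ≤ α * (Ht ^ 2 / (2 * μ)) * (B + c) * t ^ (-(1 / 2 + 2 / 7) : ℝ) := by
    have hap := (hR.a_pos k).le
    calc a k * (Ht ^ 2 / (2 * μ)) * w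
        ≤ a k * (Ht ^ 2 / (2 * μ)) * ((B + c) * t ^ (-(2 / 7) : ℝ)) := by gcongr
      _ = α * (Ht ^ 2 / (2 * μ)) * (B + c) * (t ^ (-(1 / 2) : ℝ) * t ^ (-(2 / 7) : ℝ)) := by
          rw [hak]; ring
      _ = _ := by rw [← Real.rpow_add ht0, neg_add]
  have h6 : a k ^ 2 * E ≤ α ^ 2 * t ^ (-(1 / 2 + 2 / 7) : ℝ) * E := by gcongr
  refine h1.trans ?_
  rw [show μ / 2 * a k = μ / 2 * α * t ^ (-(1 / 2) : ℝ) by rw [hak]; ring]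
  linarith

/-- The divergence between the mixed strategies is at most the one between the strategies. -/
theorem lintegral_klBar_mix_le [IsProbabilityMeasure P] (hF : G.SupportFloor xs S ε) (k : ℕ) :
    ∫⁻ ω, klBar (mix (ν k) (xs (θ k ω))) (mixedSeq ν x (k + 1) ω) ∂P
      ≤ ENNReal.ofReal (∫ ω, klReal (xs (θ k ω)) (x (k + 1) ω) ∂P) := by
  have hD := hR.integrable_klReal hF k (hR.x_mem (k + 1)) (hR.est.x_measurable (k + 1))
  rw [ofReal_integral_eq_lintegral_ofReal hD
    (ae_of_all _ (hR.klReal_nonneg k (hR.x_mem (k + 1))))]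
  refine lintegral_mono fun ω => ?_
  have hx := hR.game.mem (hR.theta_mem k ω)
  have hy := hR.x_mem (k + 1) ω
  have hmix := hR.simplex.mix_mem hR.game.convex hx (hR.ν_pos k).le (hR.ν_le_one k)
  rw [klBar_eq_ofReal_klReal (hR.simplex.block_mem hmix)
    (hR.simplex.block_mem (hR.mixed_mem (k + 1) ω))
    fun p h => absurd h (hR.mixed_pos k ω p).ne']
  refine ENNReal.ofReal_le_ofReal ((klReal_mix_mix_le (hR.ν_pos k) (hR.ν_le_one k)
    (hR.simplex.nonneg hx) (hR.simplex.nonneg hy)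
    (hR.game.eq_zero_of_eq_zero (hR.theta_mem k ω) hy)).trans ?_)
  have := mul_nonneg (hR.ν_pos k).le (hR.klReal_nonneg k (hR.x_mem (k + 1)) ω)
  linarith

end Run

end IncentiveDesign

theorem theorem2 {m n : ℕ} {d : Fin n → ℕ} [NeZero n]
    {Ω : Type*} [MeasurableSpace Ω] (P : MeasureTheory.Measure Ω)
    [MeasureTheory.IsProbabilityMeasure P]
    (G : IncentiveDesign.Design m n d)
    (xs : IncentiveDesign.Param m → IncentiveDesign.Profile d)
    (Jhat : IncentiveDesign.Param m → IncentiveDesign.Profile d →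
      Matrix (Σ i, Fin (d i)) (Σ i, Fin (d i)) ℝ)
    (gradF : IncentiveDesign.Param m → IncentiveDesign.Param m)
    (Hu ρθ ρx μ M Ht δf δu V α β : ℝ) (a b ν : ℕ → ℝ)
    (vhat : ℕ → Ω → IncentiveDesign.Profile d) (ghat : ℕ → Ω → IncentiveDesign.Param m)
    (θ : ℕ → Ω → IncentiveDesign.Param m) (x : ℕ → Ω → IncentiveDesign.Profile d)
    (θs : IncentiveDesign.Param m)
    -- the strategies are probability vectors, and the three assumptions hold
    (hsimplex : G.SimplexConstrained xs)
    (hgame : G.GameAssumption xs Hu ρθ ρx)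
    (hobj : G.ObjectiveAssumption xs Jhat gradF μ M Ht)
    (hest : IncentiveDesign.EstimateAssumption P G Jhat ν vhat ghat θ x δf δu)
    -- step sizes and mixing weights
    (hα : 0 < α) (hβ : 0 < β)
    (ha : ∀ k : ℕ, a k = α / ((k : ℝ) + 1) ^ (1 / 2 : ℝ))
    (hb : ∀ k : ℕ, b k = β / ((k : ℝ) + 1) ^ (2 / 7 : ℝ))
    (hν : ∀ k : ℕ, ν k = 1 / ((k : ℝ) + 1) ^ (4 / 7 : ℝ))
    (hβ_le : β ≤ 1 / (6 * (n : ℝ) * Hu ^ 2 * ∑ i, G.lam i ^ 2))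
    (hα_le : α / β ^ (3 / 2 : ℝ) ≤
      1 / (7 * Ht * ((1 + ((∑ i, d i : ℕ) : ℝ)) * ρθ / ρx)))
    -- bounded payoff gradients at the equilibria
    (hV : 0 < V)
    (hV_bound : ∀ t ∈ G.Θ, ∀ i, ‖IncentiveDesign.block (G.v t (xs t)) i‖ ≤ V)
    -- the algorithm, and the optimal parameter
    (htraj : IncentiveDesign.IsTrajectory G a b ν vhat ghat θ x)
    (hθs : θs ∈ G.Θ) (hθs_min : IsMinOn (G.reduced xs) G.Θ θs) :
    (∃ C : ℝ, ∀ k : ℕ, 1 ≤ k →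
      ∫⁻ ω, ENNReal.ofReal (‖θ k ω - θs‖ ^ 2) ∂P
        ≤ ENNReal.ofReal (C * (k : ℝ) ^ (-(2 / 7) : ℝ))) ∧
    (∃ C : ℝ, ∀ k : ℕ,
      ∫⁻ ω, IncentiveDesign.klBar (IncentiveDesign.mix (ν k) (xs (θ k ω)))
          (IncentiveDesign.mixedSeq ν x (k + 1) ω) ∂P
        ≤ ENNReal.ofReal (C * ((k : ℝ) + 1) ^ (-(2 / 7) : ℝ))) := by
  obtain ⟨ε, hF⟩ := hgame.exists_supportFloor hsimplex hθs
  have hR : IncentiveDesign.Run P G xs Jhat gradF Hu ρθ ρx μ M Ht δf δu a b ν vhat ghat θ x :=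
    { simplex := hsimplex
      game := hgame
      obj := hobj
      est := hest
      traj := htraj
      a_pos := fun k => by rw [ha]; positivity
      b_pos := fun k => by rw [hb]; positivity
      ν_pos := fun k => by rw [hν]; positivity
      ν_le_one := fun k => by
        rw [hν]
        refine div_le_one_of_le₀ (Real.one_le_rpow ?_ (by norm_num)) (by positivity)
        linarith [k.cast_nonneg (α := ℝ)] }
  obtain ⟨B, -, hB⟩ := hR.exists_agents_rate hF hV_bound hβ ha hb hν
  obtain ⟨C, hC0, hC⟩ := hR.exists_designer_rate hF hθs hθs_min hα ha hν hB
  refine ⟨⟨C, fun k hk => ?_⟩, ⟨B, fun k => ?_⟩⟩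
  · rw [← ofReal_integral_eq_lintegral_ofReal (hR.integrable_sq_dist hθs k)
      (ae_of_all _ fun ω => sq_nonneg _)]
    refine ENNReal.ofReal_le_ofReal ((hC k).trans ?_)
    have hk0 : (0 : ℝ) < k := by exact_mod_cast hk
    exact mul_le_mul_of_nonneg_left
      (Real.rpow_le_rpow_of_nonpos hk0 (by linarith) (by norm_num)) hC0
  · exact (hR.lintegral_klBar_mix_le hF k).trans (ENNReal.ofReal_le_ofReal (hB k))
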